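/- A Young diagram is a finite subset $Y\subset\mathbb Z_{\ge 0}^2$ such that $(i,j)\in Y$, $0\le i'\le i$ and $0\le j'\le j$ imply $(i',j')\in Y$; its elements are called boxes, $|Y|$ is the number of boxes (the empty diagram is included), and $\mathcal Y$ is the set of all Young diagrams. For a box $s=(i,j)\in Y$ let $$l_Y(s)=|\{(i',j')\in Y : j'=j\}|-i-1,\qquad a_Y(s)=|\{(i',j')\in Y : i'=i\}|-j-1 .$$ **Theorem.** Let $\alpha$ and $\beta$ be two arbitrary positive coprime integers. Then the following identity holds in the ring $\mathbb Z[q][[t]]$ of formal power series in $t$ with coefficients in $\mathbb Z[q]$ (the sum and both infinite products converge there): $$\sum_{Y\in\mathcal Y}q^{\#\{s\in Y\,:\,\alpha\, l_Y(s)=\beta(a_Y(s)+1)\}}\,t^{|Y|}=\prod_{\substack{i\ge 1\\(\alpha+\beta)\nmid i}}\frac{1}{1-t^i}\;\prod_{i\ge 1}\frac{1}{1-q\,t^{(\alpha+\beta)i}}.$$ -/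

import Mathlib

open scoped PowerSeries.WithPiTopology

namespace YoungDiagram

/-- The leg length `l_Y(i, j) = |{(i', j') ∈ Y | j' = j}| - i - 1` of a point `s = (i, j)`.
(In Mathlib `colLen j` is the number of cells whose second coordinate is `j`.) -/
def legLength (Y : YoungDiagram) (s : ℕ × ℕ) : ℤ := (Y.colLen s.2 : ℤ) - s.1 - 1

/-- The arm length `a_Y(i, j) = |{(i', j') ∈ Y | i' = i}| - j - 1` of a point `s = (i, j)`.
(In Mathlib `rowLen i` is the number of cells whose first coordinate is `i`.) -/
def armLength (Y : YoungDiagram) (s : ℕ × ℕ) : ℤ := (Y.rowLen s.1 : ℤ) - s.2 - 1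

/-- The number of boxes `s ∈ Y` with `α l(s) = β (a(s) + 1)`. -/
def armLegCount (α β : ℕ) (Y : YoungDiagram) : ℕ :=
  (Y.cells.filter fun s => (α : ℤ) * Y.legLength s = (β : ℤ) * (Y.armLength s + 1)).card

end YoungDiagram

namespace QTSeries

/-- The coefficient ring `ℤ[q]` carries the discrete topology, so that `ℤ[q]⟦t⟧`, with the topology
of coefficientwise convergence, has the usual (`t`-adic) topology of formal power series in `t`. -/
instance : TopologicalSpace (Polynomial ℤ) := ⊥

instance : DiscreteTopology (Polynomial ℤ) := ⟨rfl⟩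

/-- The variable `q` as an element of `ℤ[q]⟦t⟧`. -/
noncomputable def q : PowerSeries (Polynomial ℤ) := PowerSeries.C Polynomial.X

/-- The variable `t` of `ℤ[q]⟦t⟧`. -/
noncomputable def t : PowerSeries (Polynomial ℤ) := PowerSeries.X

/-- The multiplicative inverse `1 / f` in `ℤ[q]⟦t⟧` of a series `f` with constant term `1`. -/
noncomputable def inv (f : PowerSeries (Polynomial ℤ)) : PowerSeries (Polynomial ℤ) :=
  PowerSeries.invOfUnit f 1

/-- `inv f` is the inverse of `f`. -/
theorem mul_inv (f : PowerSeries (Polynomial ℤ)) (hf : PowerSeries.constantCoeff f = 1) :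
    f * inv f = 1 :=
  PowerSeries.mul_invOfUnit f 1 (by simpa using hf)

/-- `1 / (1 - t ^ i)` is a true inverse for `i ≥ 1`. -/
theorem one_sub_t_pow_mul_inv {i : ℕ} (hi : 1 ≤ i) : (1 - t ^ i) * inv (1 - t ^ i) = 1 :=
  mul_inv _ (by simp [t, Nat.one_le_iff_ne_zero.mp hi])

/-- `1 / (1 - q t ^ i)` is a true inverse for `i ≥ 1`. -/
theorem one_sub_q_mul_t_pow_mul_inv {i : ℕ} (hi : 1 ≤ i) :
    (1 - q * t ^ i) * inv (1 - q * t ^ i) = 1 :=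
  mul_inv _ (by simp [t, Nat.one_le_iff_ne_zero.mp hi])

end QTSeries

/-! Put c = α + β. By coprimality, the boxes counted are those whose hook length is divisible by c
and for which a/(l+1) < x ≤ (a+1)/l at x = α/β (`armLegCount_eq_lowerCount`). Among diagrams with N
boxes this statistic has the same distribution for every slope x > 0. Between consecutive quotients
k/l with 1 ≤ k, l ≤ N nothing changes; crossing such a quotient amounts to exchanging the strict and
the weak inequality (`sum_lowerCount_eq_sum_upperCount`). For small x only boxes at row ends
survive, and a part of multiplicity m contributes ⌊m/c⌋ of them. The series is therefore a product
over n of ∑_j q^⌊j/c⌋ t^(nj), and Glaisher's theorem brings it to the stated form.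

The exchange at x = p/r is a fact about closed walks. The boundary of a diagram is a walk in ℤ × ℤ/c
with steps a = (r, 1) and b = (-p, 1), closed for a suitable bounding box. A box is a step a
together with a later step b, and the displacement between their starting points is (arm + 1) a +
leg b. The two statistics differ only in counting the displacement 0 or the displacement a - b, that
is, pairs of steps with a common start or with a common end.

Fix the multisets of departure points of both kinds of steps. They determine the multiset of
displacements symmetrized under d ↦ a - b - d (`dispTF_symm_eq`), hence the number of boxes and the
common part of the two statistics. It remains to see that the two counts are equidistributed. A
t-analogue of the BEST theorem (`trailGF_eq`) evaluates the distribution of the first as a product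
of local factors times a Laplacian determinant. Reversing the walk exchanges the two counts; it
preserves the local product (`trailWeight_rev`), and also the determinant, since a diagonal matrix
built from a potential conjugates the reversed Laplacian to the transpose of the original
(`det_lap_rev`). In these lemmas a real t > 0 plays the role of q. -/

namespace LatticeTrail

open Multiset

/-! ### Walks with two kinds of steps and their displacements -/

variable {V : Type*} [AddCommGroup V]

/-- The endpoint of the walk from `u` that reads `true` as a step `a` and `false` as a step `b`. -/
def endpt (a b : V) : V → List Bool → V
  | u, [] => u
  | u, true :: w => endpt a b (u + a) w
  | u, false :: w => endpt a b (u + b) w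

/-- The points from which the walk makes a step `a`. -/
def depT (a b : V) : V → List Bool → Multiset V
  | _, [] => 0
  | u, true :: w => u ::ₘ depT a b (u + a) w
  | u, false :: w => depT a b (u + b) w

/-- The points from which the walk makes a step `b`. -/
def depF (a b : V) : V → List Bool → Multiset V
  | _, [] => 0
  | u, true :: w => depF a b (u + a) w
  | u, false :: w => u ::ₘ depF a b (u + b) w

/-- The displacements from a step `a` to a later step `b`, between starting points. -/
def dispTF (a b : V) : List Bool → Multiset V
  | [] => 0
  | true :: w => depF a b a w + dispTF a b w
  | false :: w => dispTF a b w

/-- The displacements from a step `a` to a later step `a`. -/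
def dispTT (a b : V) : List Bool → Multiset V
  | [] => 0
  | true :: w => depT a b a w + dispTT a b w
  | false :: w => dispTT a b w

section Walk

variable (a b : V)

theorem endpt_add (u v : V) (w : List Bool) : endpt a b (u + v) w = u + endpt a b v w := by
  induction w generalizing v with
  | nil => rfl
  | cons x w ih => cases x <;> simp [endpt, add_assoc, ih]

theorem depT_add (u v : V) (w : List Bool) :
    depT a b (u + v) w = (depT a b v w).map (u + ·) := by
  induction w generalizing v with
  | nil => rfl
  | cons x w ih => cases x <;> simp [depT, add_assoc, ih]

theorem depF_add (u v : V) (w : List Bool) :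
    depF a b (u + v) w = (depF a b v w).map (u + ·) := by
  induction w generalizing v with
  | nil => rfl
  | cons x w ih => cases x <;> simp [depF, add_assoc, ih]

theorem endpt_append (u : V) (w w' : List Bool) :
    endpt a b u (w ++ w') = endpt a b (endpt a b u w) w' := by
  induction w generalizing u with
  | nil => rfl
  | cons x w ih => cases x <;> simp [endpt, ih]

theorem depT_append (u : V) (w w' : List Bool) :
    depT a b u (w ++ w') = depT a b u w + depT a b (endpt a b u w) w' := by
  induction w generalizing u with
  | nil => simp [depT, endpt]
  | cons x w ih => cases x <;> simp [depT, endpt, ih]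

theorem depF_append (u : V) (w w' : List Bool) :
    depF a b u (w ++ w') = depF a b u w + depF a b (endpt a b u w) w' := by
  induction w generalizing u with
  | nil => simp [depF, endpt]
  | cons x w ih => cases x <;> simp [depF, endpt, ih]

theorem card_depT_add_card_depF (u : V) (w : List Bool) :
    (depT a b u w).card + (depF a b u w).card = w.length := by
  induction w generalizing u with
  | nil => rfl
  | cons x w ih =>
    cases x
    · simp [depT, depF, ← ih (u + b), add_assoc]
    · simp [depT, depF, ← ih (u + a), add_right_comm]

theorem card_depT (u : V) (w : List Bool) : (depT a b u w).card = w.count true := by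
  induction w generalizing u with
  | nil => rfl
  | cons x w ih => cases x <;> simp [depT, ih]

theorem endpt_eq (u : V) (w : List Bool) :
    endpt a b u w = u + w.count true • a + w.count false • b := by
  induction w generalizing u with
  | nil => simp [endpt]
  | cons x w ih => cases x <;> simp [endpt, ih, add_smul] <;> abel

/-- Conservation of flow along a walk. -/
theorem flow (u : V) (w : List Bool) :
    endpt a b u w ::ₘ (depT a b u w + depF a b u w) =
      u ::ₘ ((depT a b u w).map (· + a) + (depF a b u w).map (· + b)) := by
  induction w generalizing u with
  | nil => rfl
  | cons x w ih =>
    cases x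
    · simp only [endpt, depT, depF, map_cons, add_cons]
      rw [cons_swap, ih]
    · simp only [endpt, depT, depF, map_cons, cons_add]
      rw [cons_swap, ih]

/-- This is `flow` applied to the remainder of the walk after each step a, with positions measured
from the start of that step, and summed over these steps. -/
theorem dispTF_flow (u : V) (w : List Bool) :
    dispTF a b w + dispTT a b w + (depT a b u w).map (endpt a b u w - ·) =
      (dispTF a b w).map (· + b) + (dispTT a b w).map (· + a) +
        (depT a b u w).map (fun _ => a) := by
  induction w generalizing u with
  | nil => rfl
  | cons x w ih =>
    cases x
    · simpa only [endpt, depT, dispTF, dispTT] using ih (u + b)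
    · have h1 := ih (u + a)
      have h2 := flow a b a w
      have h3 : endpt a b (u + a) w - u = endpt a b a w := by rw [endpt_add]; abel
      simp only [endpt, depT, dispTF, dispTT, map_cons, map_add, h3]
      rw [← singleton_add, ← singleton_add] at h2
      rw [← singleton_add, ← singleton_add]
      calc _ = ({endpt a b a w} + (depT a b a w + depF a b a w)) +
            (dispTF a b w + dispTT a b w +
              (depT a b (u + a) w).map (endpt a b (u + a) w - ·)) := by abel
        _ = _ := by rw [h1, h2]; abel

/-- Each unordered pair of steps a yields a difference and its negative, and the diagonal yields
zeros; so the symmetrized multiset depends on the departures alone. -/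
theorem dispTT_add_neg (u : V) (w : List Bool) :
    dispTT a b w + (dispTT a b w).map (- ·) + (depT a b u w).map (fun _ => 0) =
      (depT a b u w).bind fun x => (depT a b u w).map (· - x) := by
  induction w generalizing u with
  | nil => rfl
  | cons x w ih =>
    cases x
    · simpa only [depT, dispTT] using ih (u + b)
    · have h1 := ih (u + a)
      have h2 : (depT a b (u + a) w).map (· - u) = depT a b a w := by
        rw [depT_add, map_map]; simp
      have h3 : (depT a b (u + a) w).map (u - ·) = (depT a b a w).map (- ·) := by
        rw [depT_add, map_map]; simp
      simp only [depT, dispTT, cons_bind, map_cons, sub_self, bind_cons, h2, h3, ← h1, map_add]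
      rw [← singleton_add, ← singleton_add]
      abel

end Walk

/-! ### Cancellation along rays, and the symmetrized displacements -/

section Ray

variable {a b : V}

open scoped Classical in
/-- The number of elements of `m` of the form `v + k b` with `k ≥ 0`. -/
noncomputable def rayCount (b v : V) (m : Multiset V) : ℕ :=
  m.countP fun x => ∃ k : ℕ, x = v + k • b

theorem rayCount_add (v : V) (m m' : Multiset V) :
    rayCount b v (m + m') = rayCount b v m + rayCount b v m' := by
  classical exact countP_add _ _ _

theorem rayCount_map_add (v c : V) (m : Multiset V) :
    rayCount b v (m.map (· + c)) = rayCount b (v - c) m := by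
  classical
  unfold rayCount
  rw [countP_map, countP_eq_card_filter]
  congr 2
  funext x
  simp only [eq_iff_iff]
  refine exists_congr fun k => ⟨fun h => ?_, fun h => ?_⟩
  · rw [eq_sub_of_add_eq h]; abel
  · rw [h]; abel

theorem rayCount_succ [DecidableEq V] (hb : ∀ k : ℕ, k ≠ 0 → k • b ≠ 0) (v : V) (m : Multiset V) :
    rayCount b v m = m.count v + rayCount b (v + b) m := by
  induction m using Multiset.induction_on with
  | empty => simp [rayCount]
  | cons x m ih =>
    unfold rayCount at ih ⊢
    rw [countP_cons, countP_cons, count_cons, ih]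
    by_cases hx : x = v
    · subst hx
      have h1 : ∃ k : ℕ, x = x + k • b := ⟨0, by simp⟩
      have h2 : ¬ ∃ k : ℕ, x = x + b + k • b := by
        rintro ⟨k, hk⟩
        refine hb (k + 1) k.succ_ne_zero ?_
        rw [add_assoc, left_eq_add] at hk
        rw [add_smul, one_smul, add_comm, hk]
      simp only [if_pos h1, if_neg h2, if_true]
      ring
    · have h : (∃ k : ℕ, x = v + k • b) ↔ ∃ k : ℕ, x = v + b + k • b := by
        constructor
        · rintro ⟨k, hk⟩
          cases k with
          | zero => simp at hk; exact absurd hk hx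
          | succ k => exact ⟨k, by rw [hk, add_smul, one_smul]; abel⟩
        · rintro ⟨k, hk⟩
          exact ⟨k + 1, by rw [hk, add_smul, one_smul]; abel⟩
      rw [if_neg (Ne.symm hx)]
      by_cases h' : ∃ k : ℕ, x = v + b + k • b
      · simp only [if_pos h', if_pos (h.mpr h')]
        ring
      · simp only [if_neg h', if_neg (mt h.mp h')]
        ring

/-- The difference of the multiplicities is invariant under translation by b and finitely supported,
hence zero as b has infinite order. Counting on rays replaces the infinite telescoping. -/
theorem eq_of_add_map_add (hb : ∀ k : ℕ, k ≠ 0 → k • b ≠ 0) {A B : Multiset V}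
    (h : A + B.map (· + b) = B + A.map (· + b)) :
    A = B := by
  classical
  ext v
  have h1 : rayCount b (v + b) _ = rayCount b (v + b) _ := congrArg (rayCount b (v + b)) h
  simp only [rayCount_add, rayCount_map_add, add_sub_cancel_right] at h1
  have h2 := rayCount_succ hb v A
  have h3 := rayCount_succ hb v B
  lia

theorem dispTF_symm_eq (hb : ∀ k : ℕ, k ≠ 0 → k • b ≠ 0) {u : V}
    {w w' : List Bool} (hT : depT a b u w = depT a b u w')
    (hF : depF a b u w = depF a b u w') :
    dispTF a b w + (dispTF a b w).map (a - b - ·) =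
      dispTF a b w' + (dispTF a b w').map (a - b - ·) := by
  have hz : endpt a b u w = endpt a b u w' := by
    have h1 := flow a b u w
    rw [hT, hF, ← flow a b u w', cons_inj_left] at h1
    exact h1
  -- Add `dispTF_flow` to its image under x ↦ a - x. The a-to-a displacements then occur only
  -- symmetrized, so everything outside the multiset sought is a function of the departures and the
  -- endpoint.
  have key : ∀ w, dispTF a b w + (dispTF a b w).map (a - b - ·) +
      (((depT a b u w).bind fun x => (depT a b u w).map (· - x)) +
        (depT a b u w).map (endpt a b u w - ·) + (depT a b u w).map (fun _ => 0) +
        (depT a b u w).map (fun _ => a)) =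
      (dispTF a b w + (dispTF a b w).map (a - b - ·)).map (· + b) +
      (((depT a b u w).bind fun x => (depT a b u w).map (· - x)).map (· + a) +
        (depT a b u w).map (fun x => a - (endpt a b u w - x)) + (depT a b u w).map (fun _ => a) +
        (depT a b u w).map (fun _ => 0)) := by
    intro w
    have h1 := dispTF_flow a b u w
    have h2 := congrArg (Multiset.map (a - ·)) h1
    have h3 := dispTT_add_neg a b u w
    simp only [map_add, map_map, Function.comp_def] at h2 ⊢
    rw [← h3]
    simp only [map_add, map_map, Function.comp_def, zero_add, sub_self] at h2 ⊢
    have e1 : ∀ x : V, a - (x + b) = a - b - x := fun x => by abel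
    have e2 : ∀ x : V, a - (x + a) = -x := fun x => by abel
    have e3 : ∀ x : V, a - b - x + b = a - x := fun x => by abel
    have e4 : ∀ x : V, -x + a = a - x := fun x => by abel
    simp only [e1, e2, e3, e4] at h2 ⊢
    calc _ = (dispTF a b w + dispTT a b w + (depT a b u w).map (endpt a b u w - ·)) +
          ((dispTF a b w).map (a - b - ·) + (dispTT a b w).map (- ·) +
            (depT a b u w).map (fun _ => 0)) + (depT a b u w).map (fun _ => 0) +
            (depT a b u w).map (fun _ => a) := by abel
      _ = _ := by rw [h1, ← h2]; abel
  have k1 := key w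
  have k2 := key w'
  rw [hT, hz] at k1
  refine eq_of_add_map_add hb ?_
  generalize dispTF a b w + (dispTF a b w).map (a - b - ·) = Q at k1 ⊢
  generalize dispTF a b w' + (dispTF a b w').map (a - b - ·) = Q' at k2 ⊢
  generalize (((depT a b u w').bind fun x => (depT a b u w').map (· - x)) +
        (depT a b u w').map (endpt a b u w' - ·) + (depT a b u w').map (fun _ => 0) +
        (depT a b u w').map (fun _ => a)) = X at k1 k2
  generalize (((depT a b u w').bind fun x => (depT a b u w').map (· - x)).map (· + a) +
        (depT a b u w').map (fun x => a - (endpt a b u w' - x)) + (depT a b u w').map (fun _ => a) +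
        (depT a b u w').map (fun _ => 0)) = Y at k1 k2
  have : Q + Q'.map (· + b) + (X + Y) = Q' + Q.map (· + b) + (X + Y) := by
    calc _ = (Q + X) + (Q'.map (· + b) + Y) := by abel
      _ = (Q' + X) + (Q.map (· + b) + Y) := by rw [k1, ← k2, add_comm]
      _ = _ := by abel
  exact add_right_cancel this

end Ray

end LatticeTrail

/-! ### t-integers, the generating function of trails and the weighted Laplacian -/

namespace LatticeTrail

open Multiset

/-- The `t`-analogue `1 + t + ⋯ + t ^ (n - 1)` of `n`. -/
noncomputable def qInt (t : ℝ) (n : ℕ) : ℝ := ∑ i ∈ Finset.range n, t ^ i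

/-- The `t`-analogue of the factorial. -/
noncomputable def qFact (t : ℝ) (n : ℕ) : ℝ := ∏ i ∈ Finset.range n, qInt t (i + 1)

/-- `qInt t n`, with the value `1` at `n = 0`. -/
noncomputable def qDiag (t : ℝ) (n : ℕ) : ℝ := if n = 0 then 1 else qInt t n

section QInt

variable {t : ℝ}

@[simp] theorem qInt_zero : qInt t 0 = 0 := rfl

@[simp] theorem qInt_one : qInt t 1 = 1 := by simp [qInt]

theorem qInt_add (m n : ℕ) : qInt t (m + n) = qInt t m + t ^ m * qInt t n := by
  simp [qInt, Finset.sum_range_add, pow_add, Finset.mul_sum]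

theorem qInt_pos (ht : 0 < t) {n : ℕ} (hn : 0 < n) : 0 < qInt t n :=
  Finset.sum_pos (fun i _ => pow_pos ht i) (by simpa using hn.ne')

theorem qDiag_of_pos {n : ℕ} (hn : 0 < n) : qDiag t n = qInt t n := if_neg hn.ne'

theorem qFact_succ (n : ℕ) : qFact t (n + 1) = qFact t n * qInt t (n + 1) :=
  Finset.prod_range_succ _ _

theorem qFact_pos (ht : 0 < t) (n : ℕ) : 0 < qFact t n :=
  Finset.prod_pos fun i _ => qInt_pos ht i.succ_pos

end QInt

/-- The lists of length `n`. -/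
def words : ℕ → Finset (List Bool)
  | 0 => {[]}
  | n + 1 => (words n).image (List.cons true) ∪ (words n).image (List.cons false)

theorem mem_words {n : ℕ} {w : List Bool} : w ∈ words n ↔ w.length = n := by
  induction n generalizing w with
  | zero => simp [words]
  | succ n ih => cases w with
    | nil => simp [words]
    | cons x w => cases x <;> simp [words, ih]

theorem sum_words_succ (n : ℕ) (f : List Bool → ℝ) :
    ∑ w ∈ words (n + 1), f w =
      ∑ w ∈ words n, f (true :: w) + ∑ w ∈ words n, f (false :: w) := by
  rw [words, Finset.sum_union, Finset.sum_image, Finset.sum_image]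
  · simp
  · simp
  · rw [Finset.disjoint_left]
    simp only [Finset.mem_image, not_exists, not_and, forall_exists_index, and_imp]
    rintro _ w _ rfl w' _
    simp

variable {V : Type*} [AddCommGroup V] [DecidableEq V]

/-- The generating function of the walks of length `n` from `u` to `z` with given departures,
counted by the pairs of a step `a` and a later step `b` with the same starting point. -/
noncomputable def trailGF (a b : V) (t : ℝ) (z : V) (n : ℕ) (u : V) (e s : Multiset V) : ℝ :=
  ∑ w ∈ words n, if depT a b u w = e ∧ depF a b u w = s ∧ endpt a b u w = z then
    t ^ (dispTF a b w).count 0 else 0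

theorem cons_eq_iff_erase {V : Type*} [DecidableEq V] {u : V} {m e : Multiset V} :
    u ::ₘ m = e ↔ u ∈ e ∧ m = e.erase u := by
  constructor
  · rintro rfl; simp
  · rintro ⟨h, rfl⟩; exact cons_erase h

theorem count_zero_depF (a b u : V) (w : List Bool) :
    (depF a b a w).count 0 = (depF a b (u + a) w).count u := by
  rw [depF_add]
  simpa using (count_map_eq_count' (u + ·) (depF a b a w) (add_right_injective u) 0).symm

/-- A first step a from u forms a pair of displacement 0 with every departure b from u, all of which
come later; a first step b starts no pair. -/
theorem trailGF_succ (a b : V) (t : ℝ) (z : V) (n : ℕ) (u : V) (e s : Multiset V) :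
    trailGF a b t z (n + 1) u e s =
      (if u ∈ e then t ^ s.count u * trailGF a b t z n (u + a) (e.erase u) s else 0) +
      (if u ∈ s then trailGF a b t z n (u + b) e (s.erase u) else 0) := by
  rw [trailGF, sum_words_succ]
  congr 1
  · rw [trailGF]
    split_ifs with hu
    · rw [Finset.mul_sum]
      refine Finset.sum_congr rfl fun w _ => ?_
      simp only [depT, depF, endpt, dispTF, cons_eq_iff_erase, hu, true_and, count_add,
        count_zero_depF a b u, mul_ite, mul_zero, pow_add]
      split_ifs with h
      · rw [h.2.1]
      · rfl
    · refine Finset.sum_eq_zero fun w _ => if_neg ?_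
      simp [depT, cons_eq_iff_erase, hu]
  · rw [trailGF]
    split_ifs with hu
    · refine Finset.sum_congr rfl fun w _ => ?_
      simp only [depT, depF, endpt, dispTF, cons_eq_iff_erase, hu, true_and]
    · refine Finset.sum_eq_zero fun w _ => if_neg ?_
      simp [depF, cons_eq_iff_erase, hu]

/-- A vector supported at `v`, `v + a` and `v + b`. -/
noncomputable def lapEntry (a b : V) (d x y : ℝ) (v w : V) : ℝ :=
  (if w = v then d else 0) - (if w = v + a then x else 0) - (if w = v + b then y else 0)

/-- The weighted Laplacian of the graph with edges `v → v + a` and `v → v + b`, of multiplicities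
given by `e` and `s`, restricted to `S`. -/
noncomputable def lap (a b : V) (t : ℝ) (S : Finset V) (e s : Multiset V) : Matrix S S ℝ :=
  Matrix.of fun v w => lapEntry a b (qDiag t (e.count v.1 + s.count v.1)) (qInt t (e.count v.1))
    (t ^ e.count v.1 * qInt t (s.count v.1)) v.1 w.1

/-- The contribution of a vertex with `i` departures `a` and `j` departures `b`. -/
noncomputable def vertexWeight (t : ℝ) (i j : ℕ) : ℝ :=
  qFact t (i + j - 1) / (qFact t i * qFact t j)

/-- The contribution of the final vertex. -/
noncomputable def sinkWeight (t : ℝ) (i j : ℕ) : ℝ := qFact t (i + j) / (qFact t i * qFact t j)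

/-- The product of the contributions of the vertices. -/
noncomputable def trailWeight {V : Type*} [DecidableEq V] (t : ℝ) (S : Finset V)
    (z : V) (e s : Multiset V) : ℝ :=
  (∏ v ∈ S, vertexWeight t (e.count v) (s.count v)) * sinkWeight t (e.count z) (s.count z)

section Weights

variable {t : ℝ}

theorem vertexWeight_left (ht : 0 < t) {i j : ℕ} (h : 0 < i + j) :
    vertexWeight t i j * qInt t (i + j) = vertexWeight t (i + 1) j * qInt t (i + 1) := by
  obtain ⟨k, hk⟩ := Nat.exists_eq_add_of_lt h
  have h1 := (qFact_pos ht i).ne'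
  have h2 := (qFact_pos ht j).ne'
  have h3 := (qInt_pos ht i.succ_pos).ne'
  rw [vertexWeight, vertexWeight, show i + 1 + j - 1 = k + 1 by omega,
    show i + j - 1 = k by omega, show i + j = k + 1 by omega, qFact_succ, qFact_succ]
  field_simp

theorem vertexWeight_right (ht : 0 < t) {i j : ℕ} (h : 0 < i + j) :
    vertexWeight t i j * qInt t (i + j) = vertexWeight t i (j + 1) * qInt t (j + 1) := by
  have := vertexWeight_left ht (i := j) (j := i) (by omega)
  simpa only [vertexWeight, add_comm, mul_comm, add_left_comm] using this

theorem sinkWeight_left (ht : 0 < t) (i j : ℕ) :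
    sinkWeight t i j * qInt t (i + 1 + j) = sinkWeight t (i + 1) j * qInt t (i + 1) := by
  have h1 := (qFact_pos ht i).ne'
  have h2 := (qFact_pos ht j).ne'
  have h3 := (qInt_pos ht i.succ_pos).ne'
  rw [sinkWeight, sinkWeight, show i + 1 + j = i + j + 1 by omega, qFact_succ, qFact_succ]
  field_simp

theorem sinkWeight_right (ht : 0 < t) (i j : ℕ) :
    sinkWeight t i j * qInt t (i + (j + 1)) = sinkWeight t i (j + 1) * qInt t (j + 1) := by
  have h1 := (qFact_pos ht i).ne'
  have h2 := (qFact_pos ht j).ne'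
  have h3 := (qInt_pos ht j.succ_pos).ne'
  rw [sinkWeight, sinkWeight, ← add_assoc, qFact_succ, qFact_succ]
  field_simp

end Weights

/-! ### Laplacian determinants when an edge is removed -/

section Det

variable {a b : V} {t : ℝ} {S : Finset V} {z u : V} {e s : Multiset V}

theorem sum_lapEntry (d x y : ℝ) (v : V) (f : V → ℝ) (hf : ∀ w, w ∉ S → f w = 0) :
    ∑ w : S, lapEntry a b d x y v w.1 * f w.1 =
      d * f v - x * f (v + a) - y * f (v + b) := by
  rw [Finset.sum_coe_sort S (fun w => lapEntry a b d x y v w * f w)]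
  simp only [lapEntry, sub_mul, ite_mul, zero_mul, Finset.sum_sub_distrib, Finset.sum_ite_eq']
  congr 1
  · congr 1
    · split_ifs with h
      · rfl
      · simp [hf _ h]
    · split_ifs with h
      · rfl
      · simp [hf _ h]
  · split_ifs with h
    · rfl
    · simp [hf _ h]

theorem lap_congr {e' s' : Multiset V} (he : ∀ v ∈ S, e.count v = e'.count v)
    (hs : ∀ v ∈ S, s.count v = s'.count v) : lap a b t S e s = lap a b t S e' s' := by
  ext v w
  simp only [lap, Matrix.of_apply, he v.1 v.2, hs v.1 v.2]

theorem lap_eq_updateRow {e' s' : Multiset V} (hu : u ∈ S) (he : ∀ v ≠ u, e'.count v = e.count v)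
    (hs : ∀ v ≠ u, s'.count v = s.count v) :
    lap a b t S e' s' = (lap a b t S e s).updateRow ⟨u, hu⟩ fun w =>
      lapEntry a b (qDiag t (e'.count u + s'.count u)) (qInt t (e'.count u))
        (t ^ e'.count u * qInt t (s'.count u)) u w.1 := by
  ext v w
  rw [Matrix.updateRow_apply]
  split_ifs with h
  · subst h; rfl
  · have : v.1 ≠ u := fun h' => h (Subtype.ext h')
    simp only [lap, Matrix.of_apply, he v.1 this, hs v.1 this]

/-- The Laplacian of a nonempty balanced graph without edges at `z` is singular. -/
theorem det_lap_eq_zero (hS : ∀ v ∈ e + s, v ≠ z → v ∈ S) (hz : z ∉ e + s) (hne : e + s ≠ 0)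
    (hbal : e + s = e.map (· + a) + s.map (· + b)) : (lap a b t S e s).det = 0 := by
  rw [← Matrix.exists_mulVec_eq_zero_iff]
  obtain ⟨v₀, hv₀⟩ := exists_mem_of_ne_zero hne
  have hmem : ∀ v ∈ e + s, v ∈ S := fun v hv => hS v hv fun h => hz (h ▸ hv)
  -- The indicator of the support is in the kernel: balance puts the head of every edge in the
  -- support, and the edge weights of a row add up to its diagonal entry by `qInt_add`.
  refine ⟨fun w => if w.1 ∈ e + s then 1 else 0, fun h => ?_, ?_⟩
  · have := congrFun h ⟨v₀, hmem v₀ hv₀⟩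
    simp [hv₀] at this
  · ext v
    simp only [Matrix.mulVec, dotProduct, lap, Matrix.of_apply, Pi.zero_apply]
    rw [sum_lapEntry _ _ _ _ (fun w => if w ∈ e + s then (1 : ℝ) else 0)
      (fun w hw => if_neg fun h => hw (hmem w h))]
    have ha : qInt t (e.count v.1) * (if v.1 + a ∈ e + s then (1 : ℝ) else 0) =
        qInt t (e.count v.1) := by
      by_cases h : v.1 ∈ e
      · rw [if_pos, mul_one]
        rw [hbal]
        exact mem_add.mpr (Or.inl (mem_map_of_mem _ h))
      · simp [count_eq_zero_of_notMem h]
    have hb : qInt t (s.count v.1) * (if v.1 + b ∈ e + s then (1 : ℝ) else 0) =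
        qInt t (s.count v.1) := by
      by_cases h : v.1 ∈ s
      · rw [if_pos, mul_one]
        rw [hbal]
        exact mem_add.mpr (Or.inr (mem_map_of_mem _ h))
      · simp [count_eq_zero_of_notMem h]
    rw [ha, mul_assoc, hb]
    by_cases hv : v.1 ∈ e + s
    · have hp : 0 < e.count v.1 + s.count v.1 := by
        rw [← count_add]; exact count_pos.mpr hv
      rw [if_pos hv, qDiag_of_pos hp, qInt_add]
      ring
    · have h0 := count_eq_zero_of_notMem hv
      rw [count_add] at h0
      rw [if_neg hv, show e.count v.1 = 0 by omega, show s.count v.1 = 0 by omega]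
      simp

/-- Removing the only departure from a vertex without arrivals. -/
theorem det_lap_last {e' s' : Multiset V} (hu : u ∈ S) (he : ∀ v ≠ u, e'.count v = e.count v)
    (hs : ∀ v ≠ u, s'.count v = s.count v) (he' : e'.count u = 0) (hs' : s'.count u = 0)
    (hone : e.count u + s.count u = 1) (hina : e.count (u - a) = 0) (hinb : s.count (u - b) = 0) :
    (lap a b t S e s).det = (lap a b t S e' s').det := by
  set M := lap a b t S e s
  have hrow : M ⟨u, hu⟩ = (fun w : S => lapEntry a b 1 0 0 u w.1) +
      fun w : S => lapEntry a b 0 (qInt t (e.count u)) (t ^ e.count u * qInt t (s.count u)) u w.1 := by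
    ext w
    simp only [M, lap, Matrix.of_apply, lapEntry, hone, qDiag_of_pos one_pos, qInt_one, Pi.add_apply,
      ite_self]
    ring
  -- Split the row of u into its diagonal term and its edge terms. Without arrivals at u, the edge
  -- part leaves the column of u zero.
  have h1 : M.det = (M.updateRow ⟨u, hu⟩ fun w : S => lapEntry a b 1 0 0 u w.1).det +
      (M.updateRow ⟨u, hu⟩ fun w : S => lapEntry a b 0 (qInt t (e.count u))
        (t ^ e.count u * qInt t (s.count u)) u w.1).det := by
    rw [← Matrix.det_updateRow_add, ← hrow, Matrix.updateRow_eq_self]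
  have hcol : ∀ v : V, (if u = v + a then qInt t (e.count v) else 0) = 0 ∧
      (if u = v + b then t ^ e.count v * qInt t (s.count v) else 0) = 0 := by
    intro v
    constructor
    · split_ifs with h
      · rw [h, add_sub_cancel_right] at hina
        simp [hina]
      · rfl
    · split_ifs with h
      · rw [h, add_sub_cancel_right] at hinb
        simp [hinb]
      · rfl
  have h2 : (M.updateRow ⟨u, hu⟩ fun w : S => lapEntry a b 0 (qInt t (e.count u))
        (t ^ e.count u * qInt t (s.count u)) u w.1).det = 0 := by
    refine Matrix.det_eq_zero_of_column_eq_zero ⟨u, hu⟩ fun v => ?_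
    rw [Matrix.updateRow_apply]
    split_ifs with h
    · simp only [lapEntry, (hcol u).1, (hcol u).2, ite_self, sub_zero]
    · have : u ≠ v.1 := fun h' => h (Subtype.ext h'.symm)
      simp only [M, lap, Matrix.of_apply, lapEntry, (hcol v).1, (hcol v).2, if_neg this, sub_zero]
  rw [h1, h2, add_zero, lap_eq_updateRow hu he hs, he', hs']
  simp [qDiag, M]

/-- Linearity of the determinant in the row of a vertex with at least two departures. -/
theorem det_lap_row {e₁ s₁ e₂ s₂ : Multiset V} {i j : ℕ} (hu : u ∈ S)
    (hij : e.count u = i ∧ s.count u = j) (h2 : 2 ≤ i + j)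
    (h₁ : 0 < i → (∀ v ≠ u, e₁.count v = e.count v) ∧ (∀ v ≠ u, s₁.count v = s.count v) ∧
      e₁.count u + 1 = i ∧ s₁.count u = j)
    (h₂ : 0 < j → (∀ v ≠ u, e₂.count v = e.count v) ∧ (∀ v ≠ u, s₂.count v = s.count v) ∧
      e₂.count u = i ∧ s₂.count u + 1 = j) :
    qInt t (i + j - 1) * (lap a b t S e s).det =
      t ^ j * qInt t i * (lap a b t S e₁ s₁).det + qInt t j * (lap a b t S e₂ s₂).det := by
  set M := lap a b t S e s with hM
  set r₁ : S → ℝ := fun w => lapEntry a b (qInt t (i + j - 1)) (qInt t (i - 1))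
    (t ^ (i - 1) * qInt t j) u w.1 with hr₁
  set r₂ : S → ℝ := fun w => lapEntry a b (qInt t (i + j - 1)) (qInt t i)
    (t ^ i * qInt t (j - 1)) u w.1 with hr₂
  -- The factor `qInt t i` makes the truncated `i - 1` in `r₁` harmless at `i = 0`; likewise for `j`
  -- below.
  have d₁ : qInt t i * (lap a b t S e₁ s₁).det = qInt t i * (M.updateRow ⟨u, hu⟩ r₁).det := by
    rcases Nat.eq_zero_or_pos i with h | h
    · simp [h]
    · obtain ⟨k1, k2, k3, k4⟩ := h₁ h
      rw [lap_eq_updateRow hu k1 k2, hr₁, show e₁.count u = i - 1 by omega, k4,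
        qDiag_of_pos (by omega), show i - 1 + j = i + j - 1 by omega]
  have d₂ : qInt t j * (lap a b t S e₂ s₂).det = qInt t j * (M.updateRow ⟨u, hu⟩ r₂).det := by
    rcases Nat.eq_zero_or_pos j with h | h
    · simp [h]
    · obtain ⟨k1, k2, k3, k4⟩ := h₂ h
      rw [lap_eq_updateRow hu k1 k2, hr₂, show s₂.count u = j - 1 by omega, k3,
        qDiag_of_pos (by omega), show i + (j - 1) = i + j - 1 by omega]
  have hrow : qInt t (i + j - 1) • M ⟨u, hu⟩ = (t ^ j * qInt t i) • r₁ + qInt t j • r₂ := by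
    ext w
    have hd : qInt t (i + j - 1) * qDiag t (i + j) =
        t ^ j * qInt t i * qInt t (i + j - 1) + qInt t j * qInt t (i + j - 1) := by
      rw [qDiag_of_pos (by omega), add_comm i j, qInt_add]
      ring
    have hx : qInt t (i + j - 1) * qInt t i =
        t ^ j * qInt t i * qInt t (i - 1) + qInt t j * qInt t i := by
      rcases Nat.eq_zero_or_pos i with h | h
      · simp [h]
      · rw [show i + j - 1 = j + (i - 1) by omega, qInt_add]
        ring
    have hy : qInt t (i + j - 1) * (t ^ i * qInt t j) =
        t ^ j * qInt t i * (t ^ (i - 1) * qInt t j) + qInt t j * (t ^ i * qInt t (j - 1)) := by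
      rcases Nat.eq_zero_or_pos j with h | h
      · simp [h]
      · rcases Nat.eq_zero_or_pos i with h' | h'
        · subst h'
          simp
          ring
        · obtain ⟨i, rfl⟩ : ∃ k, i = k + 1 := ⟨i - 1, by omega⟩
          obtain ⟨j, rfl⟩ : ∃ k, j = k + 1 := ⟨j - 1, by omega⟩
          rw [show i + 1 + (j + 1) - 1 = j + (i + 1) by omega, qInt_add]
          simp only [Nat.add_sub_cancel]
          ring
    simp only [hM, hr₁, hr₂, lap, Matrix.of_apply, lapEntry, hij.1, hij.2, Pi.add_apply, Pi.smul_apply,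
      smul_eq_mul]
    split_ifs <;> simp only [sub_zero, zero_sub, mul_sub, mul_neg, mul_zero, hd, hx, hy] <;> ring
  have hdet : qInt t (i + j - 1) * M.det =
      t ^ j * qInt t i * (M.updateRow ⟨u, hu⟩ r₁).det + qInt t j * (M.updateRow ⟨u, hu⟩ r₂).det := by
    rw [← Matrix.det_updateRow_smul, ← Matrix.det_updateRow_smul, ← Matrix.det_updateRow_add, ← hrow,
      Matrix.det_updateRow_smul, Matrix.updateRow_eq_self]
  rw [hdet, mul_assoc, mul_assoc, d₁, d₂]

end Det

end LatticeTrail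

/-! ### The t-analogue of the BEST theorem -/

namespace LatticeTrail

open Multiset

section Weights

variable {V : Type*} [DecidableEq V] {t : ℝ} {S : Finset V} {z u : V} {e s : Multiset V}

theorem trailWeight_of_mem (hu : u ∈ S) {e' s' : Multiset V} (hz : z ∉ S)
    (he : ∀ v ≠ u, e'.count v = e.count v) (hs : ∀ v ≠ u, s'.count v = s.count v) :
    trailWeight t S z e' s' = vertexWeight t (e'.count u) (s'.count u) *
      ((∏ v ∈ S.erase u, vertexWeight t (e.count v) (s.count v)) *
        sinkWeight t (e.count z) (s.count z)) := by
  have hzu : z ≠ u := fun h => hz (h ▸ hu)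
  rw [trailWeight, ← Finset.mul_prod_erase _ _ hu, he z hzu, hs z hzu, mul_assoc]
  congr 2
  refine Finset.prod_congr rfl fun v hv => ?_
  rw [he v (Finset.ne_of_mem_erase hv), hs v (Finset.ne_of_mem_erase hv)]

theorem trailWeight_of_sink {e' s' : Multiset V} (hz : z ∉ S)
    (he : ∀ v ≠ z, e'.count v = e.count v) (hs : ∀ v ≠ z, s'.count v = s.count v) :
    trailWeight t S z e' s' = sinkWeight t (e'.count z) (s'.count z) *
      ∏ v ∈ S, vertexWeight t (e.count v) (s.count v) := by
  rw [trailWeight, mul_comm]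
  congr 1
  refine Finset.prod_congr rfl fun v hv => ?_
  have : v ≠ z := fun h => hz (h ▸ hv)
  rw [he v this, hs v this]

end Weights

variable {V : Type*} [AddCommGroup V] [DecidableEq V] {a b : V} {t : ℝ} {S : Finset V} {z u : V}
  {e s : Multiset V}

/-- Edges leaving z do not enter the determinant, so only the sink factor changes and the recursion
of `trailGF_succ` reduces to [i + j] = [j] + t^j [i]. -/
theorem trail_step_sink (ht : 0 < t) (hz : z ∉ S) (h : 0 < (e + s).count z) :
    trailWeight t S z e s * (lap a b t S e s).det =
      (if z ∈ e then t ^ s.count z *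
        (trailWeight t S z (e.erase z) s * (lap a b t S (e.erase z) s).det) else 0) +
      (if z ∈ s then trailWeight t S z e (s.erase z) * (lap a b t S e (s.erase z)).det else 0) := by
  have hne : ∀ v ∈ S, v ≠ z := fun v hv h => hz (h ▸ hv)
  have he : ∀ v ≠ z, (e.erase z).count v = e.count v := fun v hv => count_erase_of_ne hv e
  have hs : ∀ v ≠ z, (s.erase z).count v = s.count v := fun v hv => count_erase_of_ne hv s
  rw [lap_congr (e := e.erase z) (e' := e) (s := s) (s' := s) (fun v hv => he v (hne v hv))
    (fun _ _ => rfl), lap_congr (e := e) (e' := e) (s := s.erase z) (s' := s) (fun _ _ => rfl)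
    (fun v hv => hs v (hne v hv)),
    trailWeight_of_sink hz (e' := e) (s' := s) (fun _ _ => rfl) (fun _ _ => rfl),
    trailWeight_of_sink hz (s' := s) he (fun _ _ => rfl),
    trailWeight_of_sink hz (e' := e) (fun _ _ => rfl) hs]
  simp only [count_erase_self]
  set i := e.count z with hi
  set j := s.count z with hj
  set P := ∏ v ∈ S, vertexWeight t (e.count v) (s.count v)
  set D := (lap a b t S e s).det
  rw [count_add] at h
  have hpos := (qInt_pos ht h).ne'
  have k1 : (if z ∈ e then t ^ j * (sinkWeight t (i - 1) j * P * D) else 0) * qInt t (i + j) =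
      t ^ j * (sinkWeight t i j * qInt t i) * P * D := by
    split_ifs with hze
    · have hi' : 0 < i := count_pos.mpr hze
      obtain ⟨k, hk⟩ : ∃ k, i = k + 1 := ⟨i - 1, by omega⟩
      rw [hk, Nat.add_sub_cancel, ← sinkWeight_left ht]
      ring
    · have : i = 0 := count_eq_zero.mpr hze
      simp [this]
  have k2 : (if z ∈ s then sinkWeight t i (j - 1) * P * D else 0) * qInt t (i + j) =
      sinkWeight t i j * qInt t j * P * D := by
    split_ifs with hzs
    · have hj' : 0 < j := count_pos.mpr hzs
      obtain ⟨k, hk⟩ : ∃ k, j = k + 1 := ⟨j - 1, by omega⟩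
      rw [hk, Nat.add_sub_cancel, ← sinkWeight_right ht]
      ring
    · have : j = 0 := count_eq_zero.mpr hzs
      simp [this]
  refine mul_right_cancel₀ hpos ?_
  rw [add_mul, k1, k2, add_comm i j, qInt_add]
  ring

/-- The determinant obeys the recursion of `trailGF_succ` by linearity in the row of u, the local
factor absorbing the t-integers. A last departure is exceptional, because `qDiag` is 1 rather than 0
once no departure is left. -/
theorem trail_step_mem (ht : 0 < t) (hz : z ∉ S) (hu : u ∈ S) (h : 0 < (e + s).count u)
    (hina : (e + s).count u = 1 → e.count (u - a) = 0 ∧ s.count (u - b) = 0) :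
    trailWeight t S z e s * (lap a b t S e s).det =
      (if u ∈ e then t ^ s.count u *
        (trailWeight t S z (e.erase u) s * (lap a b t S (e.erase u) s).det) else 0) +
      (if u ∈ s then trailWeight t S z e (s.erase u) * (lap a b t S e (s.erase u)).det else 0) := by
  have he : ∀ v ≠ u, (e.erase u).count v = e.count v := fun v hv => count_erase_of_ne hv e
  have hs : ∀ v ≠ u, (s.erase u).count v = s.count v := fun v hv => count_erase_of_ne hv s
  rw [trailWeight_of_mem hu hz (e' := e) (s' := s) (fun _ _ => rfl) (fun _ _ => rfl),
    trailWeight_of_mem hu hz (s' := s) he (fun _ _ => rfl),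
    trailWeight_of_mem hu hz (e' := e) (fun _ _ => rfl) hs]
  simp only [count_erase_self]
  rw [count_add] at h hina
  set P := (∏ v ∈ S.erase u, vertexWeight t (e.count v) (s.count v)) *
        sinkWeight t (e.count z) (s.count z)
  by_cases hone : e.count u + s.count u = 1
  · obtain ⟨ha, hb⟩ := hina hone
    by_cases hue : u ∈ e
    · have h1 := count_pos.mpr hue
      have hs0 : s.count u = 0 := by omega
      have he1 : e.count u = 1 := by omega
      rw [if_pos hue, if_neg (count_eq_zero.mp hs0), det_lap_last (e' := e.erase u) (s' := s) hu he
        (fun _ _ => rfl) (by simp [he1]) hs0 hone ha hb, hs0, he1]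
      simp [vertexWeight, qFact]
    · have he0 : e.count u = 0 := count_eq_zero.mpr hue
      have hs1 : s.count u = 1 := by omega
      rw [if_neg hue, if_pos (count_pos.mp (by omega)), det_lap_last (e' := e) (s' := s.erase u) hu
        (fun _ _ => rfl) hs he0 (by simp [hs1]) hone ha hb, hs1, he0]
      simp [vertexWeight, qFact]
  · have key := det_lap_row (a := a) (b := b) (t := t) (e := e) (s := s) (e₁ := e.erase u) (s₁ := s)
      (e₂ := e) (s₂ := s.erase u) hu ⟨rfl, rfl⟩ (by omega)
      (fun h => ⟨he, fun _ _ => rfl, by rw [count_erase_self]; omega, rfl⟩)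
      (fun h => ⟨fun _ _ => rfl, hs, rfl, by rw [count_erase_self]; omega⟩)
    set i := e.count u with hi
    set j := s.count u with hj
    set D := (lap a b t S e s).det
    set D₁ := (lap a b t S (e.erase u) s).det
    set D₂ := (lap a b t S e (s.erase u)).det
    have hpos := (qInt_pos ht (show 0 < i + j - 1 by omega)).ne'
    have k1 : (if u ∈ e then t ^ j * (vertexWeight t (i - 1) j * P * D₁) else 0) *
        qInt t (i + j - 1) = vertexWeight t i j * P * (t ^ j * qInt t i * D₁) := by
      split_ifs with hue
      · have hi' : 0 < i := count_pos.mpr hue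
        obtain ⟨k, hk⟩ : ∃ k, i = k + 1 := ⟨i - 1, by omega⟩
        have := vertexWeight_left ht (i := k) (j := j) (by omega)
        rw [hk, Nat.add_sub_cancel, show k + 1 + j - 1 = k + j by omega]
        linear_combination t ^ j * P * D₁ * this
      · have : i = 0 := count_eq_zero.mpr hue
        simp [this]
    have k2 : (if u ∈ s then vertexWeight t i (j - 1) * P * D₂ else 0) * qInt t (i + j - 1) =
        vertexWeight t i j * P * (qInt t j * D₂) := by
      split_ifs with hus
      · have hj' : 0 < j := count_pos.mpr hus
        obtain ⟨k, hk⟩ : ∃ k, j = k + 1 := ⟨j - 1, by omega⟩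
        have := vertexWeight_right ht (i := i) (j := k) (by omega)
        rw [hk, Nat.add_sub_cancel, show i + (k + 1) - 1 = i + k by omega]
        linear_combination P * D₂ * this
      · have : j = 0 := count_eq_zero.mpr hus
        simp [this]
    refine mul_right_cancel₀ hpos ?_
    rw [add_mul, k1, k2]
    linear_combination vertexWeight t i j * P * key

/-- The determinantal formula for the generating function of walks with given departures. -/
theorem trailGF_eq (ht : 0 < t) (hz : z ∉ S) (n : ℕ) (hS : ∀ v ∈ e + s, v ≠ z → v ∈ S)
    (hcard : (e + s).card = n)
    (hbal : z ::ₘ (e + s) = u ::ₘ (e.map (· + a) + s.map (· + b))) :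
    trailGF a b t z n u e s = trailWeight t S z e s * (lap a b t S e s).det := by
  induction n generalizing e s u with
  | zero =>
    rw [card_eq_zero] at hcard
    obtain ⟨rfl, rfl⟩ : e = 0 ∧ s = 0 := by simpa using hcard
    have huz : u = z := by simpa using hbal.symm
    -- The value of `qDiag` at 0 gives vertices without departures an identity row, so unused points
    -- of `S` do no harm.
    have hlap : lap a b t S 0 0 = 1 := by
      ext v w
      rcases eq_or_ne v w with rfl | h
      · simp [lap, lapEntry, qDiag]
      · simp [lap, lapEntry, h, h.symm]
    simp [trailGF, words, depT, depF, endpt, dispTF, huz, hlap, trailWeight, vertexWeight,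
      sinkWeight, qFact]
  | succ n ih =>
    rw [trailGF_succ]
    have hT : ∀ h : u ∈ e, trailGF a b t z n (u + a) (e.erase u) s =
        trailWeight t S z (e.erase u) s * (lap a b t S (e.erase u) s).det := by
      intro h
      obtain ⟨e', rfl⟩ := exists_cons_of_mem h
      rw [erase_cons_head]
      refine ih (fun v hv => hS v (by simp at hv ⊢; tauto)) (by simpa using hcard) ?_
      rw [cons_add, map_cons, cons_add, cons_swap, cons_inj_right] at hbal
      exact hbal
    have hF : ∀ h : u ∈ s, trailGF a b t z n (u + b) e (s.erase u) =
        trailWeight t S z e (s.erase u) * (lap a b t S e (s.erase u)).det := by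
      intro h
      obtain ⟨s', rfl⟩ := exists_cons_of_mem h
      rw [erase_cons_head]
      refine ih (fun v hv => hS v (by simp at hv ⊢; tauto)) (by simpa using hcard) ?_
      rw [add_cons, map_cons, add_cons, cons_swap, cons_inj_right] at hbal
      exact hbal
    have hrw : ((if u ∈ e then t ^ s.count u * trailGF a b t z n (u + a) (e.erase u) s else 0) +
      (if u ∈ s then trailGF a b t z n (u + b) e (s.erase u) else 0)) =
      (if u ∈ e then t ^ s.count u *
        (trailWeight t S z (e.erase u) s * (lap a b t S (e.erase u) s).det) else 0) +
      (if u ∈ s then trailWeight t S z e (s.erase u) * (lap a b t S e (s.erase u)).det else 0) := by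
      congr 1
      · split_ifs with h
        · rw [hT h]
        · rfl
      · split_ifs with h
        · rw [hF h]
        · rfl
    rw [hrw]
    by_cases huz : u = z
    · subst huz
      by_cases h0 : u ∈ e + s
      · exact (trail_step_sink ht hz (count_pos.mpr h0)).symm
      -- The walk is stuck at the sink with edges left over: no continuation exists, and the
      -- balanced remaining graph has a singular Laplacian.
      · rw [det_lap_eq_zero hS h0 _ ((cons_inj_right u).mp hbal)]
        · have : u ∉ e ∧ u ∉ s := by simpa using h0
          simp [this]
        · rintro h
          simp [h] at hcard
    · have hmem : u ∈ e + s := by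
        have : u ∈ z ::ₘ (e + s) := hbal ▸ mem_cons_self _ _
        exact (mem_cons.mp this).resolve_left huz
      refine (trail_step_mem ht hz (hS u hmem huz) (count_pos.mpr hmem) fun h1 => ?_).symm
      -- If u has a single departure, the start of the walk already accounts for it in the balance,
      -- so no step arrives at u.
      have h2 := congrArg (count u) hbal
      rw [count_cons_of_ne huz, h1, count_cons_self, count_add] at h2
      have h3 : (e.map (· + a)).count u = e.count (u - a) := by
        have := count_map_eq_count' (· + a) e (add_left_injective a) (u - a)
        rwa [sub_add_cancel] at this
      have h4 : (s.map (· + b)).count u = s.count (u - b) := by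
        have := count_map_eq_count' (· + b) s (add_left_injective b) (u - b)
        rwa [sub_add_cancel] at this
      omega

end LatticeTrail

/-! ### Reversal of walks -/

namespace LatticeTrail

open Multiset

/-- The word of the walk traversed backwards, a backward step `b` being read as `true`. -/
def revWord (w : List Bool) : List Bool := (w.map not).reverse

theorem revWord_cons (x : Bool) (w : List Bool) : revWord (x :: w) = revWord w ++ [!x] := by
  simp [revWord]

theorem revWord_revWord (w : List Bool) : revWord (revWord w) = w := by
  simp [revWord, Function.comp_def]

theorem length_revWord (w : List Bool) : (revWord w).length = w.length := by
  simp [revWord]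

theorem sum_words_revWord (n : ℕ) (f : List Bool → ℝ) :
    ∑ w ∈ words n, f (revWord w) = ∑ w ∈ words n, f w :=
  Finset.sum_nbij' revWord revWord (fun w hw => by simpa [mem_words, length_revWord] using hw)
    (fun w hw => by simpa [mem_words, length_revWord] using hw) (fun w _ => revWord_revWord w)
    (fun w _ => revWord_revWord w) (fun _ _ => rfl)

variable {V : Type*} [AddCommGroup V]

theorem endpt_revWord (a b u : V) (w : List Bool) :
    endpt (-b) (-a) (endpt a b u w) (revWord w) = u := by
  induction w generalizing u with
  | nil => rfl
  | cons x w ih => cases x <;> simp [endpt, revWord_cons, endpt_append, ih]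

theorem depT_revWord (a b u : V) (w : List Bool) :
    depT (-b) (-a) (endpt a b u w) (revWord w) = (depF a b u w).map (· + b) := by
  induction w generalizing u with
  | nil => rfl
  | cons x w ih =>
    cases x
    · simp [endpt, depT, depF, revWord_cons, depT_append, ih, endpt_revWord, ← singleton_add,
        add_comm]
    · simp [endpt, depT, depF, revWord_cons, depT_append, ih]

theorem depF_revWord (a b u : V) (w : List Bool) :
    depF (-b) (-a) (endpt a b u w) (revWord w) = (depT a b u w).map (· + a) := by
  induction w generalizing u with
  | nil => rfl
  | cons x w ih =>
    cases x
    · simp [endpt, depT, depF, revWord_cons, depF_append, ih]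
    · simp [endpt, depT, depF, revWord_cons, depF_append, ih, endpt_revWord, ← singleton_add,
        add_comm]

theorem dispTF_append_true (a b : V) (w : List Bool) :
    dispTF a b (w ++ [true]) = dispTF a b w := by
  induction w with
  | nil => rfl
  | cons x w ih => cases x <;> simp [dispTF, ih, depF_append, depF]

theorem dispTF_append_false (a b u : V) (w : List Bool) :
    dispTF a b (w ++ [false]) = dispTF a b w + (depT a b u w).map (endpt a b u w - ·) := by
  induction w generalizing u with
  | nil => rfl
  | cons x w ih =>
    cases x
    · simpa [dispTF, depT, endpt] using ih (u + b)
    · have h : endpt a b (u + a) w - u = endpt a b a w := by rw [endpt_add]; abel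
      simp only [List.cons_append, dispTF, ih (u + a), depF_append, depF, depT, endpt, map_cons, h]
      rw [← singleton_add, ← singleton_add]
      abel

/-- A step a from x and a later step b from y become a step -b from y + b and a later step -a from x
+ a; the new displacement is a - b - (y - x). -/
theorem dispTF_revWord (a b : V) (w : List Bool) :
    dispTF (-b) (-a) (revWord w) = (dispTF a b w).map (a - b - ·) := by
  induction w with
  | nil => rfl
  | cons x w ih =>
    cases x
    · simpa [revWord_cons, dispTF, dispTF_append_true] using ih
    · rw [revWord_cons, Bool.not_true, dispTF_append_false (-b) (-a) (endpt a b a w), ih,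
        endpt_revWord, depT_revWord, dispTF, map_add, add_comm, map_map]
      congr 2
      funext x
      simp only [Function.comp_apply]
      abel

variable [DecidableEq V] {a b : V} {t : ℝ} {S : Finset V} {e s : Multiset V}

theorem count_map_add (m : Multiset V) (c v : V) : (m.map (· + c)).count v = m.count (v - c) := by
  have := count_map_eq_count' (· + c) m (add_left_injective c) (v - c)
  rwa [sub_add_cancel] at this

theorem dispTF_revWord_count (w : List Bool) :
    (dispTF (-b) (-a) (revWord w)).count 0 = (dispTF a b w).count (a - b) := by
  rw [dispTF_revWord]
  simpa using count_map_eq_count' (a - b - ·) (dispTF a b w) sub_right_injective (a - b)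

theorem trailGF_revWord (n : ℕ) (e s : Multiset V) :
    trailGF (-b) (-a) t 0 n 0 (s.map (· + b)) (e.map (· + a)) =
      ∑ w ∈ words n, if depT a b 0 w = e ∧ depF a b 0 w = s ∧ endpt a b 0 w = 0 then
        t ^ (dispTF a b w).count (a - b) else 0 := by
  rw [trailGF, ← sum_words_revWord]
  refine Finset.sum_congr rfl fun w _ => ?_
  rw [dispTF_revWord_count]
  by_cases h : endpt a b 0 w = 0
  · have h1 := depT_revWord a b 0 w
    have h2 := depF_revWord a b 0 w
    have h3 := endpt_revWord a b 0 w
    rw [h] at h1 h2 h3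
    rw [h1, h2, h3]
    simp only [h, (map_injective (add_left_injective b)).eq_iff,
      (map_injective (add_left_injective a)).eq_iff]
    refine if_congr ?_ rfl rfl
    tauto
  · rw [if_neg, if_neg]
    · tauto
    · rintro ⟨-, -, h3⟩
      apply h
      have h4 := endpt_revWord a b 0 w
      rw [← add_zero (endpt a b 0 w), endpt_add, h3, add_zero] at h4
      exact h4

/-! ### The potential, and the invariance of determinant and weight under reversal -/

section Potential

/-- On a balanced graph, ray counts form a potential whose differences are edge multiplicities. -/
theorem rayCount_add_left (hb : ∀ k : ℕ, k ≠ 0 → k • b ≠ 0)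
    (hbal : e + s = e.map (· + a) + s.map (· + b)) (v : V) :
    rayCount b (v + a) e = rayCount b v e + s.count (v + a - b) := by
  have h1 : rayCount b (v + a) (e + s) = _ := congrArg (rayCount b (v + a)) hbal
  rw [rayCount_add, rayCount_add, rayCount_map_add, rayCount_map_add, add_sub_cancel_right] at h1
  have h2 := rayCount_succ hb (v + a - b) s
  rw [sub_add_cancel] at h2
  omega

theorem det_lap_rev (ht : 0 < t) (hb : ∀ k : ℕ, k ≠ 0 → k • b ≠ 0)
    (hbal : e + s = e.map (· + a) + s.map (· + b)) :
    (lap (-b) (-a) t S (s.map (· + b)) (e.map (· + a))).det = (lap a b t S e s).det := by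
  -- Reversal moves the power of t from the b-edges to the a-edges. Along an edge b from v the
  -- potential drops by `e.count v`, and along an edge a into v it grows by `s.count (v - b)`:
  -- exactly the powers to be exchanged.
  set Φ : Matrix S S ℝ := Matrix.diagonal fun v => t ^ rayCount b v.1 e
  have hΦ : Φ.det ≠ 0 := by
    rw [Matrix.det_diagonal]
    exact Finset.prod_ne_zero_iff.mpr fun v _ => (pow_pos ht _).ne'
  have key : lap (-b) (-a) t S (s.map (· + b)) (e.map (· + a)) * Φ =
      Φ * (lap a b t S e s).transpose := by
    ext v w
    rw [Matrix.mul_diagonal, Matrix.diagonal_mul, Matrix.transpose_apply]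
    have hn : ((s.map (· + b)).count v.1 + (e.map (· + a)).count v.1) =
        e.count v.1 + s.count v.1 := by
      rw [← count_add, ← count_add, hbal, add_comm]
    simp only [lap, Matrix.of_apply, lapEntry, hn]
    simp only [count_map_add]
    have h1 : (if w.1 = v.1 then qDiag t (e.count v.1 + s.count v.1) else 0) *
        t ^ rayCount b w.1 e = t ^ rayCount b v.1 e *
        (if v.1 = w.1 then qDiag t (e.count w.1 + s.count w.1) else 0) := by
      by_cases h : w.1 = v.1
      · rw [if_pos h, if_pos h.symm, h, mul_comm]
      · rw [if_neg h, if_neg (Ne.symm h), zero_mul, mul_zero]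
    have h2 : (if w.1 = v.1 + -b then qInt t (s.count (v.1 - b)) else 0) *
        t ^ rayCount b w.1 e = t ^ rayCount b v.1 e *
        (if v.1 = w.1 + b then t ^ e.count w.1 * qInt t (s.count w.1) else 0) := by
      by_cases h : v.1 = w.1 + b
      · rw [if_pos h, h, add_neg_cancel_right, if_pos rfl, add_sub_cancel_right,
          rayCount_succ hb w.1 e, pow_add]
        ring
      · rw [if_neg h, if_neg, zero_mul, mul_zero]
        exact fun h' => h (by rw [h', neg_add_cancel_right])
    have h3 : (if w.1 = v.1 + -a then t ^ s.count (v.1 - b) * qInt t (e.count (v.1 - a)) else 0) *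
        t ^ rayCount b w.1 e = t ^ rayCount b v.1 e *
        (if v.1 = w.1 + a then qInt t (e.count w.1) else 0) := by
      by_cases h : v.1 = w.1 + a
      · rw [if_pos h, h, add_neg_cancel_right, if_pos rfl, add_sub_cancel_right,
          rayCount_add_left hb hbal, pow_add]
        ring
      · rw [if_neg h, if_neg, zero_mul, mul_zero]
        exact fun h' => h (by rw [h', neg_add_cancel_right])
    rw [sub_mul, sub_mul, h1, h2, h3]
    ring
  have := congrArg Matrix.det key
  rw [Matrix.det_mul, Matrix.det_mul, Matrix.det_transpose, mul_comm] at this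
  exact mul_left_cancel₀ hΦ this

theorem prod_count_map_add {f : ℕ → ℝ} (hf : f 0 = 1) {T : Finset V} {m : Multiset V} {c : V}
    (h : ∀ v ∈ m, v ∈ T) (hc : ∀ v ∈ m.map (· + c), v ∈ T) :
    ∏ v ∈ T, f ((m.map (· + c)).count v) = ∏ v ∈ T, f (m.count v) := by
  have key : ∀ m' : Multiset V, (∀ v ∈ m', v ∈ T) →
      ∏ v ∈ T, f (m'.count v) = ∏ v ∈ m'.toFinset, f (m'.count v) := fun m' hm' =>
    (Finset.prod_subset (fun v hv => hm' v (mem_toFinset.mp hv)) fun v _ hv => by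
      rw [count_eq_zero_of_notMem (fun h => hv (mem_toFinset.mpr h)), hf]).symm
  rw [key _ hc, key _ h, toFinset_map, Finset.prod_image fun x _ y _ hxy => add_left_injective c hxy]
  simp [count_map_add]

theorem trailWeight_eq_div {V : Type*} [DecidableEq V] {S : Finset V} {z : V} (hz : z ∉ S)
    (e s : Multiset V) :
    trailWeight t S z e s =
      (∏ v ∈ S, qFact t ((e + s).count v - 1)) * qFact t ((e + s).count z) /
        ((∏ v ∈ insert z S, qFact t (e.count v)) * ∏ v ∈ insert z S, qFact t (s.count v)) := by
  simp only [trailWeight, vertexWeight, sinkWeight, Finset.prod_insert hz, Finset.prod_div_distrib,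
    Finset.prod_mul_distrib, count_add]
  rw [div_mul_div_comm]
  congr 1
  ring

/-- The numerators involve only total degrees, preserved by balance; the denominators are products
over the multiplicities of `e` and of `s`, which translation merely permutes. -/
theorem trailWeight_rev (hz : (0 : V) ∉ S) (hS : ∀ v ∈ e + s, v ≠ 0 → v ∈ S)
    (hbal : e + s = e.map (· + a) + s.map (· + b)) :
    trailWeight t S 0 (s.map (· + b)) (e.map (· + a)) = trailWeight t S 0 e s := by
  have hsum : s.map (· + b) + e.map (· + a) = e + s := by rw [hbal, add_comm]
  have hT : ∀ v ∈ e + s, v ∈ insert 0 S := fun v hv => by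
    rw [Finset.mem_insert]
    exact or_iff_not_imp_left.mpr (hS v hv)
  rw [trailWeight_eq_div hz, trailWeight_eq_div hz, hsum, prod_count_map_add rfl
    (fun v hv => hT v (mem_add.mpr (Or.inr hv))) fun v hv => hT v (hsum ▸ mem_add.mpr (Or.inl hv)),
    prod_count_map_add rfl (fun v hv => hT v (mem_add.mpr (Or.inl hv)))
      fun v hv => hT v (hsum ▸ mem_add.mpr (Or.inr hv)), mul_comm (∏ v ∈ insert 0 S, _)]

end Potential

/-- Departures and arrivals are equidistributed over closed walks with given departures. -/
theorem sum_words_dep_eq_arr (ht : 0 < t) (hb : ∀ k : ℕ, k ≠ 0 → k • b ≠ 0) (n : ℕ)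
    (hcard : (e + s).card = n) :
    (∑ w ∈ words n, if depT a b 0 w = e ∧ depF a b 0 w = s ∧ endpt a b 0 w = 0 then
        t ^ (dispTF a b w).count 0 else 0) =
      ∑ w ∈ words n, if depT a b 0 w = e ∧ depF a b 0 w = s ∧ endpt a b 0 w = 0 then
        t ^ (dispTF a b w).count (a - b) else 0 := by
  by_cases hbal : e + s = e.map (· + a) + s.map (· + b)
  · have hz : (0 : V) ∉ (e + s).toFinset.erase 0 := Finset.notMem_erase _ _
    have hS : ∀ v ∈ e + s, v ≠ 0 → v ∈ (e + s).toFinset.erase 0 := fun v hv h0 =>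
      Finset.mem_erase.mpr ⟨h0, mem_toFinset.mpr hv⟩
    have hsum : s.map (· + b) + e.map (· + a) = e + s := by rw [hbal, add_comm]
    have h1 := trailGF_eq (a := a) (b := b) (u := 0) ht hz n hS hcard (by rw [← hbal])
    have h2 := trailGF_eq (a := -b) (b := -a) (u := 0) (e := s.map (· + b)) (s := e.map (· + a))
      ht hz n (by rwa [hsum]) (by rwa [hsum]) (by
        rw [hsum]
        simp [map_map, add_comm])
    rw [trailGF_revWord, det_lap_rev ht hb hbal, trailWeight_rev hz hS hbal] at h2
    exact h1.trans h2.symm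
  -- Without balance no closed walk has these departures, and both sums vanish.
  · have h0 : ∀ w, ¬ (depT a b 0 w = e ∧ depF a b 0 w = s ∧ endpt a b 0 w = 0) := by
      rintro w ⟨rfl, rfl, h3⟩
      have := flow a b 0 w
      rw [h3, cons_inj_right] at this
      exact hbal this
    simp only [h0, if_false]

end LatticeTrail

/-! ### Joint equidistribution over all closed walks -/

namespace LatticeTrail

open Multiset

variable {V : Type*} [AddCommGroup V] [DecidableEq V] {a b : V} {t : ℝ}

/-- Over closed walks, the displacements `0` and `a - b` are equidistributed, jointly with the
symmetrized multiset of displacements. -/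
theorem sum_words_symm (ht : 0 < t) (hb : ∀ k : ℕ, k ≠ 0 → k • b ≠ 0) (n : ℕ)
    (f : ℕ → Multiset V → ℝ) :
    (∑ w ∈ words n, if endpt a b 0 w = 0 then
      f (w.count true) (dispTF a b w + (dispTF a b w).map (a - b - ·)) *
        t ^ (dispTF a b w).count 0 else 0) =
    ∑ w ∈ words n, if endpt a b 0 w = 0 then
      f (w.count true) (dispTF a b w + (dispTF a b w).map (a - b - ·)) *
        t ^ (dispTF a b w).count (a - b) else 0 := by
  -- On a fibre of `g` the arguments of `f` are constant, so `f` factors out of the sum over closed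
  -- walks.
  set g : List Bool → Multiset V × Multiset V := fun w => (depT a b 0 w, depF a b 0 w)
  have hg : ∀ w ∈ words n, g w ∈ (words n).image g := fun w hw => Finset.mem_image_of_mem g hw
  rw [← Finset.sum_fiberwise_of_maps_to hg, ← Finset.sum_fiberwise_of_maps_to hg]
  refine Finset.sum_congr rfl fun y hy => ?_
  obtain ⟨w₀, hw₀, rfl⟩ := Finset.mem_image.mp hy
  have key : ∀ d : V, (∑ w ∈ words n with g w = g w₀, if endpt a b 0 w = 0 then
      f (w.count true) (dispTF a b w + (dispTF a b w).map (a - b - ·)) *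
        t ^ (dispTF a b w).count d else 0) =
      f (w₀.count true) (dispTF a b w₀ + (dispTF a b w₀).map (a - b - ·)) *
      ∑ w ∈ words n, if depT a b 0 w = depT a b 0 w₀ ∧ depF a b 0 w = depF a b 0 w₀ ∧
        endpt a b 0 w = 0 then t ^ (dispTF a b w).count d else 0 := by
    intro d
    rw [Finset.sum_filter, Finset.mul_sum]
    refine Finset.sum_congr rfl fun w _ => ?_
    by_cases h : g w = g w₀
    · obtain ⟨h1, h2⟩ := Prod.ext_iff.mp h
      simp only [g] at h1 h2
      rw [if_pos h]
      simp only [h1, h2, true_and, mul_ite, mul_zero]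
      rw [dispTF_symm_eq hb h1 h2, ← card_depT a b 0 w, ← card_depT a b 0 w₀, h1]
    · rw [if_neg h, if_neg, mul_zero]
      exact fun h' => h (Prod.ext h'.1 h'.2.1)
  rw [key, key, sum_words_dep_eq_arr ht hb n]
  rw [card_add, card_depT_add_card_depF]
  exact mem_words.mp hw₀

end LatticeTrail

/-! ### Young diagrams as boundary words -/

namespace YoungDiagram

open LatticeTrail

/-- The lengths of the columns of the Young diagram with boundary word `w`. -/
def wordCol : List Bool → ℕ → ℕ
  | [], _ => 0
  | true :: w, 0 => w.count false
  | true :: w, j + 1 => wordCol w j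
  | false :: w, j => wordCol w j

/-- The lengths of the rows of the Young diagram with boundary word `w`. -/
def wordRow : List Bool → ℕ → ℕ
  | [], _ => 0
  | true :: w, i => if i < w.count false then wordRow w i + 1 else 0
  | false :: w, i => wordRow w i

theorem wordCol_le (w : List Bool) (j : ℕ) : wordCol w j ≤ w.count false := by
  induction w generalizing j with
  | nil => simp [wordCol]
  | cons x w ih =>
    cases x
    · simpa [wordCol] using (ih j).trans (Nat.le_succ _)
    · cases j with
      | zero => simp [wordCol]
      | succ j => simpa [wordCol] using ih j

theorem wordCol_anti (w : List Bool) : Antitone (wordCol w) := by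
  refine antitone_nat_of_succ_le fun j => ?_
  induction w generalizing j with
  | nil => simp [wordCol]
  | cons x w ih =>
    cases x
    · simpa [wordCol] using ih j
    · cases j with
      | zero => simpa [wordCol] using wordCol_le w 0
      | succ j => simpa [wordCol] using ih j

theorem lt_wordRow_iff (w : List Bool) (i j : ℕ) : j < wordRow w i ↔ i < wordCol w j := by
  induction w generalizing j with
  | nil => simp [wordCol, wordRow]
  | cons x w ih =>
    cases x
    · simpa [wordCol, wordRow] using ih j
    · cases j with
      | zero => simp only [wordRow, wordCol]; split_ifs <;> simp [*]
      | succ j =>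
        simp only [wordRow, wordCol]
        split_ifs with h
        · simpa using ih j
        · have := wordCol_le w j
          constructor <;> intro <;> omega

theorem wordRow_le (w : List Bool) (i : ℕ) : wordRow w i ≤ w.count true := by
  induction w with
  | nil => simp [wordRow]
  | cons x w ih =>
    cases x
    · simpa [wordRow] using ih
    · simp only [wordRow, List.count_cons_self]
      split_ifs <;> omega

/-- The Young diagram with boundary word `w`, read from the end of the first column, `true` being
the step along a column and `false` the step along a row. -/
def ofWord (w : List Bool) : YoungDiagram where
  cells := (Finset.range (w.count false) ×ˢ Finset.range (w.count true)).filter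
    fun c => c.1 < wordCol w c.2
  isLowerSet := by
    rintro ⟨i, j⟩ ⟨i', j'⟩ ⟨hi, hj⟩ h
    simp only [Finset.coe_filter, Finset.mem_product, Finset.mem_range, Set.mem_ofPred_eq] at h hi hj ⊢
    exact ⟨⟨hi.trans_lt h.1.1, hj.trans_lt h.1.2⟩,
      hi.trans_lt (h.2.trans_le (wordCol_anti w hj))⟩

theorem mem_ofWord {w : List Bool} {i j : ℕ} : (i, j) ∈ ofWord w ↔ i < wordCol w j := by
  rw [← mem_cells]
  simp only [ofWord, Finset.mem_filter, Finset.mem_product, Finset.mem_range, and_iff_right_iff_imp]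
  intro h
  exact ⟨h.trans_le (wordCol_le w j), ((lt_wordRow_iff w i j).mpr h).trans_le (wordRow_le w i)⟩

theorem colLen_ofWord (w : List Bool) (j : ℕ) : (ofWord w).colLen j = wordCol w j :=
  eq_of_forall_lt_iff fun i => by rw [← mem_iff_lt_colLen, mem_ofWord]

theorem rowLen_ofWord (w : List Bool) (i : ℕ) : (ofWord w).rowLen i = wordRow w i :=
  eq_of_forall_lt_iff fun j => by rw [← mem_iff_lt_rowLen, mem_ofWord, lt_wordRow_iff]

theorem ext_colLen {Y Y' : YoungDiagram} (h : ∀ j, Y.colLen j = Y'.colLen j) : Y = Y' := by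
  ext ⟨i, j⟩
  rw [mem_cells, mem_cells, mem_iff_lt_colLen, mem_iff_lt_colLen, h]

/-- The first letter is read off column 0: it is `true` when that column has the full height of the
bounding box and `false` when it falls short. -/
theorem wordCol_injective {w w' : List Bool} (ht : w.count true = w'.count true)
    (hf : w.count false = w'.count false) (h : ∀ j, wordCol w j = wordCol w' j) : w = w' := by
  induction w generalizing w' with
  | nil =>
    cases w' with
    | nil => rfl
    | cons x w' => cases x <;> simp at ht hf
  | cons x w ih =>
    cases w' with
    | nil => cases x <;> simp at ht hf
    | cons x' w' =>
      cases x <;> cases x'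
      · simp only [List.count_cons_self, Nat.add_right_cancel_iff] at hf
        rw [ih (by simpa using ht) hf (by simpa [wordCol] using h)]
      · have h0 := h 0
        have := wordCol_le w 0
        simp [wordCol] at h0 hf
        omega
      · have h0 := h 0
        have := wordCol_le w' 0
        simp [wordCol] at h0 hf
        omega
      · simp only [List.count_cons_self, Nat.add_right_cancel_iff] at ht
        rw [ih ht (by simpa using hf) fun j => by simpa [wordCol] using h (j + 1)]

theorem exists_wordCol (A B : ℕ) (f : ℕ → ℕ) (hf : Antitone f) (hB : f 0 ≤ B) (hA : f A = 0) :
    ∃ w : List Bool, w.count true = A ∧ w.count false = B ∧ ∀ j, wordCol w j = f j := by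
  induction hn : A + B generalizing A B f with
  | zero =>
    obtain ⟨rfl, rfl⟩ : A = 0 ∧ B = 0 := by omega
    refine ⟨[], rfl, rfl, fun j => ?_⟩
    have := hf (Nat.zero_le j)
    simp only [wordCol]
    omega
  | succ n ih =>
    by_cases h : f 0 < B
    · obtain ⟨B, rfl⟩ : ∃ k, B = k + 1 := ⟨B - 1, by omega⟩
      obtain ⟨w, h1, h2, h3⟩ := ih A B f hf (by omega) hA (by omega)
      exact ⟨false :: w, by simpa using h1, by simpa using h2, by simpa [wordCol] using h3⟩
    · obtain ⟨A, rfl⟩ : ∃ k, A = k + 1 := by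
        refine ⟨A - 1, ?_⟩
        by_contra h'
        obtain rfl : A = 0 := by omega
        omega
      obtain ⟨w, h1, h2, h3⟩ := ih A B (fun j => f (j + 1)) (fun i j h => hf (by omega))
        ((hf (Nat.zero_le 1)).trans hB) hA (by omega)
      refine ⟨true :: w, by simpa using h1, by simpa using h2, fun j => ?_⟩
      cases j with
      | zero => simp only [wordCol]; omega
      | succ j => exact h3 j

theorem ofWord_injective {w w' : List Bool} (ht : w.count true = w'.count true)
    (hf : w.count false = w'.count false) (h : ofWord w = ofWord w') : w = w' :=
  wordCol_injective ht hf fun j => by rw [← colLen_ofWord, ← colLen_ofWord, h]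

theorem exists_ofWord {Y : YoungDiagram} {A B : ℕ} (hA : Y.rowLen 0 ≤ A) (hB : Y.colLen 0 ≤ B) :
    ∃ w : List Bool, w.count true = A ∧ w.count false = B ∧ ofWord w = Y := by
  obtain ⟨w, h1, h2, h3⟩ := exists_wordCol A B Y.colLen (fun i j h => Y.colLen_anti i j h) hB (by
    by_contra h
    have : (0, A) ∈ Y := mem_iff_lt_colLen.mpr (Nat.pos_of_ne_zero h)
    rw [mem_iff_lt_rowLen] at this
    omega)
  exact ⟨w, h1, h2, ext_colLen fun j => by rw [colLen_ofWord, h3]⟩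

/-! ### Arms and legs as displacements along the boundary -/

section HookDisp

variable {V : Type*} [AddCommGroup V]

/-- The multiset of the vectors `(a(s) + 1) a + l(s) b`. -/
def hookDisp (a b : V) (Y : YoungDiagram) : Multiset V :=
  Y.cells.val.map fun c => (Y.armLength c + 1) • a + Y.legLength c • b

/-- Rows are numbered from the end of the word: the step b of row i is preceded by `wordRow w i`
steps a and by the steps b of all rows below it. -/
theorem sum_row_singleton (a b u : V) (w : List Bool) :
    ∑ i ∈ Finset.range (w.count false),
      ({u + wordRow w i • a + (w.count false - 1 - i) • b} : Multiset V) = depF a b u w := by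
  induction w generalizing u with
  | nil => simp [depF]
  | cons x w ih =>
    cases x
    · have h0 : wordRow w (w.count false) = 0 := by
        by_contra h
        have := (lt_wordRow_iff w _ 0).mp (Nat.pos_of_ne_zero h)
        exact absurd (wordCol_le w 0) (by omega)
      rw [List.count_cons_self, Finset.sum_range_succ, depF, ← ih (u + b), add_comm,
        ← Multiset.singleton_add]
      congr 1
      · simp [wordRow, h0]
      · refine Finset.sum_congr rfl fun i hi => ?_
        rw [Finset.mem_range] at hi
        rw [show w.count false + 1 - 1 - i = w.count false - 1 - i + 1 by omega, add_smul, one_smul]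
        simp only [wordRow]
        congr 1
        abel
    · rw [depF, ← ih (u + a), List.count_cons_of_ne (by simp)]
      refine Finset.sum_congr rfl fun i hi => ?_
      rw [Finset.mem_range] at hi
      simp only [wordRow, if_pos hi, add_smul, one_smul]
      congr 1
      abel

/-- The box in row i and column j is the pair formed by the step a of column j and the later step b
of row i. -/
theorem sum_col_singleton (a b : V) (w : List Bool) :
    ∑ j ∈ Finset.range (w.count true), ∑ i ∈ Finset.range (wordCol w j),
      ({(wordRow w i - j) • a + (wordCol w j - 1 - i) • b} : Multiset V) = dispTF a b w := by
  induction w with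
  | nil => simp [dispTF]
  | cons x w ih =>
    cases x
    · rw [List.count_cons_of_ne (by simp)]
      simpa [wordRow, wordCol, dispTF] using ih
    · rw [List.count_cons_self, Finset.sum_range_succ', dispTF, ← ih, ← sum_row_singleton, add_comm]
      congr 1
      · refine Finset.sum_congr rfl fun i hi => ?_
        simp only [Finset.mem_range] at hi
        simp only [wordRow, wordCol, if_pos hi, tsub_zero, add_smul, one_smul]
        congr 1
        abel
      · refine Finset.sum_congr rfl fun j _ => Finset.sum_congr rfl fun i hi => ?_
        simp only [Finset.mem_range] at hi
        simp only [wordRow, wordCol, if_pos (hi.trans_le (wordCol_le w j)), Nat.add_sub_add_right]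

theorem hookDisp_ofWord (a b : V) (w : List Bool) : hookDisp a b (ofWord w) = dispTF a b w := by
  rw [← sum_col_singleton, hookDisp, Finset.sum_sigma', ← Multiset.sum_map_singleton (Multiset.map _ _),
    Multiset.map_map]
  change ∑ c ∈ (ofWord w).cells, _ = _
  refine Finset.sum_bij' (fun c _ => ⟨c.2, c.1⟩) (fun c _ => (c.2, c.1)) ?_ ?_ ?_ ?_ ?_
  · rintro ⟨i, j⟩ hc
    rw [mem_cells, mem_ofWord] at hc
    simpa [hc] using ((lt_wordRow_iff w i j).mpr hc).trans_le (wordRow_le w i)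
  · rintro ⟨j, i⟩ hc
    rw [mem_cells, mem_ofWord]
    simpa using (Finset.mem_sigma.mp hc).2
  · intros; rfl
  · intros; rfl
  · rintro ⟨i, j⟩ hc
    rw [mem_cells, mem_ofWord] at hc
    have hr := (lt_wordRow_iff w i j).mpr hc
    simp only [Function.comp_apply, armLength, legLength, colLen_ofWord, rowLen_ofWord]
    rw [show ((wordRow w i : ℤ) - j - 1 + 1) = ((wordRow w i - j : ℕ) : ℤ) by omega,
      show ((wordCol w j : ℤ) - i - 1) = ((wordCol w j - 1 - i : ℕ) : ℤ) by omega,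
      natCast_zsmul, natCast_zsmul]

theorem card_hookDisp (a b : V) (Y : YoungDiagram) : (hookDisp a b Y).card = Y.card := by
  simp [hookDisp, YoungDiagram.card]

end HookDisp

theorem rowLen_le_card (Y : YoungDiagram) (i : ℕ) : Y.rowLen i ≤ Y.card := by
  rw [rowLen_eq_card]
  exact Finset.card_le_card (Finset.filter_subset _ _)

theorem colLen_le_card (Y : YoungDiagram) (j : ℕ) : Y.colLen j ≤ Y.card := by
  rw [colLen_eq_card]
  exact Finset.card_le_card (Finset.filter_subset _ _)

theorem finite_card_eq (N : ℕ) : {Y : YoungDiagram | Y.card = N}.Finite := by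
  refine ((words (N + N)).finite_toSet.image ofWord).subset fun Y hY => ?_
  obtain ⟨w, h1, h2, h3⟩ := exists_ofWord (Y := Y) ((Y.rowLen_le_card 0).trans_eq hY)
    ((Y.colLen_le_card 0).trans_eq hY)
  exact ⟨w, mem_words.mpr (by rw [← List.count_true_add_count_false w, h1, h2]), h3⟩

/-- The Young diagrams with `N` boxes. -/
noncomputable def ofCard (N : ℕ) : Finset YoungDiagram := (finite_card_eq N).toFinset

theorem mem_ofCard {N : ℕ} {Y : YoungDiagram} : Y ∈ ofCard N ↔ Y.card = N :=
  (finite_card_eq N).mem_toFinset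

theorem sum_ofCard {N A B : ℕ} (hA : N ≤ A) (hB : N ≤ B) (f : YoungDiagram → ℝ) :
    ∑ Y ∈ ofCard N, f Y =
      ∑ w ∈ words (A + B), if w.count true = A ∧ (ofWord w).card = N then f (ofWord w) else 0 := by
  rw [← Finset.sum_filter]
  symm
  refine Finset.sum_bij (fun w _ => ofWord w) ?_ ?_ ?_ ?_
  · intro w hw
    exact mem_ofCard.mpr (Finset.mem_filter.mp hw).2.2
  · intro w hw w' hw' h
    simp only [Finset.mem_filter, mem_words] at hw hw'
    have h1 := List.count_true_add_count_false w
    have h2 := List.count_true_add_count_false w'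
    exact ofWord_injective (by omega) (by omega) h
  · intro Y hY
    rw [mem_ofCard] at hY
    obtain ⟨w, h1, h2, h3⟩ := exists_ofWord (Y := Y) (A := A) (B := B)
      ((Y.rowLen_le_card 0).trans (by omega)) ((Y.colLen_le_card 0).trans (by omega))
    refine ⟨w, ?_, h3⟩
    rw [Finset.mem_filter, mem_words, ← List.count_true_add_count_false w, h1, h2, h3]
    exact ⟨rfl, rfl, hY⟩
  · intros; rfl

end YoungDiagram

/-! ### Exchanging strict and weak inequalities at a rational slope -/

namespace YoungDiagram

open LatticeTrail

theorem sum_count_eq_sum_count {t : ℝ} (ht : 0 < t) {p r c : ℕ} (hp : 0 < p) (hr : 0 < r)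
    (hc : 0 < c) (N : ℕ) {a b : ℤ × ZMod c} (ha : a = ((r : ℤ), (1 : ZMod c))) (hb : b = (-(p : ℤ), (1 : ZMod c)))
    (F : ℤ × ZMod c → Prop) [DecidablePred F] (hF : ∀ d, F (a - b - d) ↔ F d) :
    ∑ Y ∈ ofCard N, t ^ ((hookDisp a b Y).countP F + (hookDisp a b Y).count 0) =
      ∑ Y ∈ ofCard N, t ^ ((hookDisp a b Y).countP F + (hookDisp a b Y).count (a - b)) := by
  -- A bounding box with p c N columns and r c N rows holds every diagram with N boxes, and its
  -- boundary closes up: p r - r p = 0 in ℤ, and the factor c kills the length in ℤ/c.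
  have hcN : N ≤ c * N := Nat.le_mul_of_pos_left N hc
  have hA : N ≤ p * (c * N) := hcN.trans (Nat.le_mul_of_pos_left _ hp)
  have hB : N ≤ r * (c * N) := hcN.trans (Nat.le_mul_of_pos_left _ hr)
  have hinf : ∀ k : ℕ, k ≠ 0 → k • b ≠ 0 := by
    intro k hk h
    have := congrArg Prod.fst h
    simp [hb, hk, hp.ne'] at this
  -- Symmetrization doubles both the number of boxes and, as `F` is symmetric, the count of `F`;
  -- hence `N + N` and an exact division by 2.
  set f : ℕ → Multiset (ℤ × ZMod c) → ℝ := fun k Q =>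
    if k = p * (c * N) ∧ Q.card = N + N then t ^ (Q.countP F / 2) else 0
  have key : ∀ d : ℤ × ZMod c,
      ∑ Y ∈ ofCard N, t ^ ((hookDisp a b Y).countP F + (hookDisp a b Y).count d) =
      ∑ w ∈ words (p * (c * N) + r * (c * N)), if endpt a b 0 w = 0 then
        f (w.count true) (dispTF a b w + (dispTF a b w).map (a - b - ·)) *
        t ^ (dispTF a b w).count d else 0 := by
    intro d
    rw [sum_ofCard hA hB]
    refine Finset.sum_congr rfl fun w hw => ?_
    have hlen := List.count_true_add_count_false w
    rw [mem_words.mp hw] at hlen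
    have hcard : (ofWord w).card = (dispTF a b w).card := by
      rw [← card_hookDisp a b, hookDisp_ofWord]
    have hcountP : ((dispTF a b w).map (a - b - ·)).countP F = (dispTF a b w).countP F := by
      rw [Multiset.countP_map, Multiset.countP_eq_card_filter]
      simp only [hF]
    rw [hookDisp_ofWord, hcard]
    simp only [f, Multiset.card_add, Multiset.card_map, Multiset.countP_add, hcountP]
    by_cases h : w.count true = p * (c * N)
    · have hend : endpt a b 0 w = 0 := by
        rw [endpt_eq, h, show w.count false = r * (c * N) by omega, ha, hb]
        ext
        · simp
          ring
        · simp
      rw [if_pos hend]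
      by_cases h' : (dispTF a b w).card = N
      · rw [if_pos ⟨h, h'⟩, if_pos ⟨h, by omega⟩, pow_add]
        congr 2
        omega
      · rw [if_neg fun hh => h' hh.2, if_neg fun hh => h' (by omega), zero_mul]
    · simp [h]
  rw [key, key, sum_words_symm ht hinf]

/-- The number of boxes with hook length divisible by `c` and `a / (l + 1) < x ≤ (a + 1) / l`. -/
def lowerCount (c : ℕ) (x : ℚ) (Y : YoungDiagram) : ℕ :=
  (Y.cells.filter fun s => (c : ℤ) ∣ Y.armLength s + 1 + Y.legLength s ∧
    (Y.armLength s : ℚ) < x * (Y.legLength s + 1) ∧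
    x * Y.legLength s ≤ Y.armLength s + 1).card

/-- The number of boxes with hook length divisible by `c` and `a / (l + 1) ≤ x < (a + 1) / l`. -/
def upperCount (c : ℕ) (x : ℚ) (Y : YoungDiagram) : ℕ :=
  (Y.cells.filter fun s => (c : ℤ) ∣ Y.armLength s + 1 + Y.legLength s ∧
    (Y.armLength s : ℚ) ≤ x * (Y.legLength s + 1) ∧
    x * Y.legLength s < Y.armLength s + 1).card

/-- The number of boxes with hook length divisible by `c` at the end of their row. -/
def rowEndCount (c : ℕ) (Y : YoungDiagram) : ℕ :=
  (Y.cells.filter fun s => (c : ℤ) ∣ Y.armLength s + 1 + Y.legLength s ∧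
    Y.armLength s = 0).card

theorem armLength_nonneg {Y : YoungDiagram} {s : ℕ × ℕ} (hs : s ∈ Y.cells) :
    0 ≤ Y.armLength s := by
  have : s.2 < Y.rowLen s.1 := mem_iff_lt_rowLen.mp ((mem_cells _).mp hs)
  unfold armLength
  omega

theorem legLength_nonneg {Y : YoungDiagram} {s : ℕ × ℕ} (hs : s ∈ Y.cells) :
    0 ≤ Y.legLength s := by
  have : s.1 < Y.colLen s.2 := mem_iff_lt_colLen.mp ((mem_cells _).mp hs)
  unfold legLength
  omega

theorem armLength_lt (Y : YoungDiagram) (s : ℕ × ℕ) : Y.armLength s < Y.card := by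
  have := Y.rowLen_le_card s.1
  unfold armLength
  omega

theorem legLength_lt (Y : YoungDiagram) (s : ℕ × ℕ) : Y.legLength s < Y.card := by
  have := Y.colLen_le_card s.2
  unfold legLength
  omega

theorem sum_lowerCount_eq_sum_upperCount {t : ℝ} (ht : 0 < t) {c : ℕ} (hc : 0 < c) {x : ℚ}
    (hx : 0 < x) (N : ℕ) :
    ∑ Y ∈ ofCard N, t ^ lowerCount c x Y = ∑ Y ∈ ofCard N, t ^ upperCount c x Y := by
  obtain ⟨p, r, hp, hr, rfl⟩ : ∃ p r : ℕ, 0 < p ∧ 0 < r ∧ x = p / r :=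
    ⟨x.num.toNat, x.den, by have := Rat.num_pos.mpr hx; omega, x.den_pos, by
      have h : ((x.num.toNat : ℤ) : ℚ) = x.num := by
        rw [Int.toNat_of_nonneg (Rat.num_pos.mpr hx).le]
      rw [← Int.cast_natCast x.num.toNat, h, Rat.num_div_den]⟩
  have hrQ : (0 : ℚ) < r := by exact_mod_cast hr
  set a : ℤ × ZMod c := ((r : ℤ), (1 : ZMod c)) with ha
  set b : ℤ × ZMod c := (-(p : ℤ), (1 : ZMod c)) with hb
  have hab : a - b = ((r + p : ℤ), (0 : ZMod c)) := by simp [ha, hb]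
  -- With first coordinate r(arm + 1) - p leg, the two statistics ask for 0 ≤ d < r + p and for 0 <
  -- d ≤ r + p. `F` is their common part; the extra displacements are 0 and a - b.
  set F : ℤ × ZMod c → Prop := fun d => d.2 = 0 ∧ 0 < d.1 ∧ d.1 < r + p
  have hF : ∀ d, F (a - b - d) ↔ F d := by
    intro d
    simp only [F, hab, Prod.snd_sub, Prod.fst_sub, zero_sub, neg_eq_zero]
    constructor <;> rintro ⟨h1, h2, h3⟩ <;> exact ⟨h1, by omega, by omega⟩
  have hdisp : ∀ (Y : YoungDiagram) (s : ℕ × ℕ),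
      (Y.armLength s + 1) • a + Y.legLength s • b =
        (r * (Y.armLength s + 1) - p * Y.legLength s,
          ((Y.armLength s + 1 + Y.legLength s : ℤ) : ZMod c)) := by
    intro Y s
    ext
    · simp [ha, hb]; ring
    · simp [ha, hb]
  have h1 : ∀ k l : ℤ, (k : ℚ) < (p / r : ℚ) * (l + 1) ↔ r * (k + 1) - p * l < r + p := by
    intro k l
    rw [div_mul_eq_mul_div, lt_div_iff₀ hrQ]
    have : (k : ℚ) * r < p * (l + 1) ↔ k * r < p * (l + 1) := by exact_mod_cast Iff.rfl
    rw [this]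
    constructor <;> intro h <;> linarith
  have h2 : ∀ k l : ℤ, (p / r : ℚ) * l ≤ k + 1 ↔ 0 ≤ r * (k + 1) - p * l := by
    intro k l
    rw [div_mul_eq_mul_div, div_le_iff₀ hrQ]
    have : (p : ℚ) * l ≤ (k + 1) * r ↔ p * l ≤ (k + 1) * r := by exact_mod_cast Iff.rfl
    rw [this]
    constructor <;> intro h <;> linarith
  have h3 : ∀ k l : ℤ, (k : ℚ) ≤ (p / r : ℚ) * (l + 1) ↔ r * (k + 1) - p * l ≤ r + p := by
    intro k l
    rw [div_mul_eq_mul_div, le_div_iff₀ hrQ]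
    have : (k : ℚ) * r ≤ p * (l + 1) ↔ k * r ≤ p * (l + 1) := by exact_mod_cast Iff.rfl
    rw [this]
    constructor <;> intro h <;> linarith
  have h4 : ∀ k l : ℤ, (p / r : ℚ) * l < k + 1 ↔ 0 < r * (k + 1) - p * l := by
    intro k l
    rw [div_mul_eq_mul_div, div_lt_iff₀ hrQ]
    have : (p : ℚ) * l < (k + 1) * r ↔ p * l < (k + 1) * r := by exact_mod_cast Iff.rfl
    rw [this]
    constructor <;> intro h <;> linarith
  have split : ∀ (m : Multiset (ℤ × ZMod c)) (d : ℤ × ZMod c), ¬ F d →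
      m.countP F + m.count d = m.countP fun y => F y ∨ y = d := by
    intro m d hd
    induction m using Multiset.induction_on with
    | empty => simp
    | cons y m ih =>
      rw [Multiset.countP_cons, Multiset.countP_cons, Multiset.count_cons, ← ih]
      by_cases hy : y = d
      · subst hy
        simp only [hd, if_true, if_false, false_or]
        ring
      · simp only [hy, or_false, if_neg (Ne.symm hy)]
        ring
  have hlow : ∀ Y, lowerCount c (p / r) Y = (hookDisp a b Y).countP F + (hookDisp a b Y).count 0 := by
    intro Y
    rw [split _ _ (by simp [F]), hookDisp, Multiset.countP_map, lowerCount, Finset.card_def,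
      Finset.filter_val]
    congr 1
    refine Multiset.filter_congr fun s _ => ?_
    rw [hdisp, h1, h2]
    simp only [F, Prod.ext_iff, Prod.fst_zero, Prod.snd_zero, ZMod.intCast_zmod_eq_zero_iff_dvd]
    generalize (r * (Y.armLength s + 1) - p * Y.legLength s : ℤ) = k
    by_cases hd : (c : ℤ) ∣ Y.armLength s + 1 + Y.legLength s <;> simp only [hd, true_and, and_true,
      false_and, and_false, or_false]
    omega
  have hupp : ∀ Y, upperCount c (p / r) Y =
      (hookDisp a b Y).countP F + (hookDisp a b Y).count (a - b) := by
    intro Y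
    rw [split _ _ (by simp [F, hab]), hookDisp, Multiset.countP_map, upperCount, Finset.card_def,
      Finset.filter_val]
    congr 1
    refine Multiset.filter_congr fun s _ => ?_
    rw [hdisp, h3, h4, hab]
    simp only [F, Prod.ext_iff, ZMod.intCast_zmod_eq_zero_iff_dvd]
    generalize (r * (Y.armLength s + 1) - p * Y.legLength s : ℤ) = k
    by_cases hd : (c : ℤ) ∣ Y.armLength s + 1 + Y.legLength s <;> simp only [hd, true_and, and_true,
      false_and, and_false, or_false]
    omega
  simp only [hlow, hupp]
  exact sum_count_eq_sum_count ht hp hr hc N ha hb F hF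

/-! ### Independence of the slope -/

/-- The slopes at which the statistics on Young diagrams with `N` boxes can jump. -/
def walls (N : ℕ) : Finset ℚ :=
  (Finset.Icc 1 N ×ˢ Finset.Icc 1 N).image fun y => (y.1 : ℚ) / y.2

theorem div_mem_walls {N : ℕ} {k l : ℤ} (hk : 0 < k) (hkN : k ≤ N) (hl : 0 < l) (hlN : l ≤ N) :
    (k / l : ℚ) ∈ walls N := by
  lift k to ℕ using hk.le
  lift l to ℕ using hl.le
  refine Finset.mem_image.mpr ⟨(k, l), ?_, by simp⟩
  simp only [Finset.mem_product, Finset.mem_Icc]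
  omega

theorem lowerCount_eq_upperCount {c : ℕ} {x y : ℚ} (hy : 0 < y) (hyx : y < x) {Y : YoungDiagram}
    (h : ∀ z ∈ walls Y.card, z < x → z ≤ y) : lowerCount c x Y = upperCount c y Y := by
  unfold lowerCount upperCount
  congr 1
  refine Finset.filter_congr fun s hs => ?_
  have ha := armLength_nonneg hs
  have hl := legLength_nonneg hs
  have ha' := Y.armLength_lt s
  have hl' := Y.legLength_lt s
  generalize Y.armLength s = k at *
  generalize Y.legLength s = l at *
  have hlQ : (0 : ℚ) < l + 1 := by exact_mod_cast (by omega : 0 < l + 1)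
  refine and_congr Iff.rfl (and_congr ?_ ?_)
  · rw [← div_lt_iff₀ hlQ, ← div_le_iff₀ hlQ]
    refine ⟨fun h' => ?_, fun h' => h'.trans_lt hyx⟩
    -- A zero arm gives the quotient 0, which is not a wall, but then both inequalities follow from
    -- positivity of the slopes.
    rcases ha.eq_or_lt with rfl | hk
    · simpa using hy.le
    · refine h _ ?_ h'
      have := div_mem_walls (N := Y.card) (l := l + 1) hk ha'.le (by omega) (by omega)
      simpa using this
  · rcases hl.eq_or_lt with rfl | hl0
    · have : (0 : ℚ) < k + 1 := by exact_mod_cast (by omega : 0 < k + 1)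
      simp [this, this.le]
    · have hl0Q : (0 : ℚ) < l := by exact_mod_cast hl0
      rw [← le_div_iff₀ hl0Q, ← lt_div_iff₀ hl0Q]
      refine ⟨fun h' => hyx.trans_le h', fun h' => ?_⟩
      by_contra h''
      have := div_mem_walls (N := Y.card) (k := k + 1) (by omega) (by omega) hl0 hl'.le
      push_cast at this
      exact absurd (h _ this (not_le.mp h'')) (not_le.mpr h')

theorem lowerCount_eq_rowEndCount {c : ℕ} {x : ℚ} (hx : 0 < x) {Y : YoungDiagram}
    (h : ∀ z ∈ walls Y.card, x ≤ z) : lowerCount c x Y = rowEndCount c Y := by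
  unfold lowerCount rowEndCount
  congr 1
  refine Finset.filter_congr fun s hs => ?_
  have ha := armLength_nonneg hs
  have hl := legLength_nonneg hs
  have ha' := Y.armLength_lt s
  have hl' := Y.legLength_lt s
  generalize Y.armLength s = k at *
  generalize Y.legLength s = l at *
  have hlQ : (0 : ℚ) < l + 1 := by exact_mod_cast (by omega : 0 < l + 1)
  refine and_congr Iff.rfl ?_
  rw [← div_lt_iff₀ hlQ]
  constructor
  · rintro ⟨h1, -⟩
    by_contra hk
    have := div_mem_walls (N := Y.card) (k := k) (l := l + 1) (by omega) ha'.le (by omega) (by omega)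
    push_cast at this
    exact absurd h1 (not_lt.mpr (h _ this))
  · rintro rfl
    refine ⟨by simpa using hx, ?_⟩
    rcases hl.eq_or_lt with rfl | hl0
    · simp
    · have hl0Q : (0 : ℚ) < l := by exact_mod_cast hl0
      rw [← le_div_iff₀ hl0Q]
      have := div_mem_walls (N := Y.card) (k := 0 + 1) (by omega) (by omega) hl0 hl'.le
      push_cast at this
      exact_mod_cast h _ this

/-- The distribution of `lowerCount` does not depend on the slope. -/
theorem sum_lowerCount_eq_sum_rowEndCount {t : ℝ} (ht : 0 < t) {c : ℕ} (hc : 0 < c) (N : ℕ) {x : ℚ}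
    (hx : 0 < x) :
    ∑ Y ∈ ofCard N, t ^ lowerCount c x Y = ∑ Y ∈ ofCard N, t ^ rowEndCount c Y := by
  induction hn : ((walls N).filter (· < x)).card using Nat.strong_induction_on generalizing x with
  | _ n ih =>
    subst hn
    rcases ((walls N).filter (· < x)).eq_empty_or_nonempty with he | hne
    · refine Finset.sum_congr rfl fun Y hY => ?_
      rw [lowerCount_eq_rowEndCount hx]
      intro z hz
      rw [mem_ofCard.mp hY] at hz
      exact not_lt.mp (Finset.filter_eq_empty_iff.mp he hz)
    -- Descend to the largest wall below x: lower at x is upper at y, equidistributed with lower at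
    -- y, which has fewer walls beneath it.
    · set y := ((walls N).filter (· < x)).max' hne with hy
      have hymem := Finset.max'_mem _ hne
      rw [← hy, Finset.mem_filter] at hymem
      have hy0 : 0 < y := by
        obtain ⟨q, hq, hqy⟩ := Finset.mem_image.mp hymem.1
        simp only [Finset.mem_product, Finset.mem_Icc] at hq
        rw [← hqy]
        have h1 : (0 : ℚ) < q.1 := by exact_mod_cast hq.1.1
        have h2 : (0 : ℚ) < q.2 := by exact_mod_cast hq.2.1
        exact div_pos h1 h2
      rw [← ih _ (Finset.card_lt_card ?_) hy0 rfl, sum_lowerCount_eq_sum_upperCount ht hc hy0]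
      · refine Finset.sum_congr rfl fun Y hY => ?_
        rw [lowerCount_eq_upperCount hy0 hymem.2]
        intro z hz hzx
        rw [mem_ofCard.mp hY] at hz
        exact Finset.le_max' _ _ (Finset.mem_filter.mpr ⟨hz, hzx⟩)
      · rw [Finset.ssubset_iff_of_subset fun z hz => ?_]
        · exact ⟨y, Finset.mem_filter.mpr hymem, by simp⟩
        · rw [Finset.mem_filter] at hz ⊢
          exact ⟨hz.1, hz.2.trans hymem.2⟩

theorem armLegCount_eq_lowerCount {α β : ℕ} (hα : 0 < α) (hβ : 0 < β) (hαβ : Nat.Coprime α β)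
    (Y : YoungDiagram) : Y.armLegCount α β = lowerCount (α + β) (α / β) Y := by
  unfold armLegCount lowerCount
  congr 1
  refine Finset.filter_congr fun s hs => ?_
  generalize Y.armLength s = k
  generalize Y.legLength s = l
  have hβQ : (0 : ℚ) < β := by exact_mod_cast hβ
  rw [div_mul_eq_mul_div, lt_div_iff₀ hβQ, div_mul_eq_mul_div, div_le_iff₀ hβQ]
  have h1 : (k : ℚ) * β < α * (l + 1) ↔ k * β < α * (l + 1) := by exact_mod_cast Iff.rfl
  have h2 : (α : ℚ) * l ≤ (k + 1) * β ↔ α * l ≤ (k + 1) * β := by exact_mod_cast Iff.rfl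
  rw [h1, h2]
  have hα' : (0 : ℤ) < α := by exact_mod_cast hα
  have hβ' : (0 : ℤ) < β := by exact_mod_cast hβ
  constructor
  · intro h
    have hcop : IsCoprime (α : ℤ) β := Nat.isCoprime_iff_coprime.mpr hαβ
    -- Coprimality enters here: arm + 1 = α m and leg = β m, so the hook length is (α + β) m.
    obtain ⟨m, hm⟩ := hcop.dvd_of_dvd_mul_left (Dvd.intro l h)
    have hl : l = β * m := by
      refine mul_left_cancel₀ hα'.ne' ?_
      rw [h, hm]
      ring
    refine ⟨⟨m, by rw [hm, hl]; push_cast; ring⟩, ?_, ?_⟩ <;> linarith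
  · rintro ⟨⟨m, hm⟩, h3, h4⟩
    push_cast at hm
    have hl : l = (α + β) * m - (k + 1) := by linarith
    subst hl
    -- After eliminating the leg, the two inequalities confine the integer k + 1 - α m to [0, 1).
    have h5 : (0 : ℤ) ≤ k + 1 - α * m := by
      by_contra h
      push Not at h
      nlinarith
    have h6 : k + 1 - α * m < 1 := by
      by_contra h
      push Not at h
      nlinarith
    have h7 : k + 1 = α * m := by omega
    rw [h7]
    ring

end YoungDiagram

/-! ### The row-end statistic in terms of partitions -/

namespace YoungDiagram

/-- The row ends in column j belong to the rows of length j + 1. If there are m of them, their hook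
lengths are 1, …, m, of which ⌊m/c⌋ are multiples of c; the bijection records the leg. -/
theorem rowEndCount_eq_sum (c : ℕ) (Y : YoungDiagram) :
    rowEndCount c Y = ∑ j ∈ Finset.range (Y.rowLen 0), (Y.colLen j - Y.colLen (j + 1)) / c := by
  unfold rowEndCount
  rw [Finset.card_eq_sum_card_fiberwise (f := Prod.snd) (t := Finset.range (Y.rowLen 0))]
  · refine Finset.sum_congr rfl fun j _ => ?_
    rw [← Nat.card_multiples]
    have hanti := Y.colLen_anti j (j + 1) (Nat.le_succ j)
    refine Finset.card_bij' (fun s _ => Y.colLen j - 1 - s.1) (fun e _ => (Y.colLen j - 1 - e, j))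
      ?_ ?_ ?_ ?_
    · rintro ⟨i, j'⟩ hs
      simp only [Finset.mem_filter, mem_cells] at hs
      simp only [armLength, legLength] at hs
      obtain ⟨⟨h1, h2, h3⟩, rfl⟩ := hs
      have h4 := mem_iff_lt_colLen.mp h1
      have h5 : ¬ i < Y.colLen (j' + 1) := by
        rw [← mem_iff_lt_colLen, mem_iff_lt_rowLen]
        omega
      simp only [Finset.mem_filter, Finset.mem_range]
      refine ⟨by omega, ?_⟩
      rw [h3] at h2
      rw [← Int.natCast_dvd_natCast]
      convert h2 using 1
      omega
    · intro e he
      simp only [Finset.mem_filter, Finset.mem_range] at he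
      have h4 : Y.colLen j - 1 - e < Y.colLen j := by omega
      have h5 : ¬ Y.colLen j - 1 - e < Y.colLen (j + 1) := by omega
      have h6 := h4
      rw [← mem_iff_lt_colLen, mem_iff_lt_rowLen] at h5 h6
      have h7 : Y.rowLen (Y.colLen j - 1 - e) = j + 1 := by omega
      simp only [Finset.mem_filter, mem_cells, mem_iff_lt_colLen, and_true]
      simp only [armLength, legLength, h7]
      refine ⟨h4, ?_, by omega⟩
      rw [← Int.natCast_dvd_natCast] at he
      convert he.2 using 1
      omega
    · rintro ⟨i, j'⟩ hs
      simp only [Finset.mem_filter, mem_cells] at hs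
      obtain ⟨⟨h1, -⟩, rfl⟩ := hs
      have h4 := mem_iff_lt_colLen.mp h1
      simp only [Prod.mk.injEq, and_true]
      omega
    · intro e he
      simp only [Finset.mem_filter, Finset.mem_range] at he
      show Y.colLen j - 1 - (Y.colLen j - 1 - e) = e
      omega
  · rintro ⟨i, j⟩ hs
    have h1 : (i, j) ∈ Y := (mem_cells _).mp (Finset.mem_filter.mp hs).1
    rw [Finset.mem_coe, Finset.mem_range]
    exact mem_iff_lt_rowLen.mp (Y.up_left_mem (Nat.zero_le i) le_rfl h1)

theorem count_rowLens (Y : YoungDiagram) (j : ℕ) :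
    (Y.rowLens : Multiset ℕ).count (j + 1) = Y.colLen j - Y.colLen (j + 1) := by
  rw [show (Y.rowLens : Multiset ℕ) = (Multiset.range (Y.colLen 0)).map Y.rowLen from rfl,
    Multiset.count_map, ← Nat.card_Ico]
  change ((Finset.range (Y.colLen 0)).filter fun i => j + 1 = Y.rowLen i).card = _
  congr 1
  ext i
  have h1 : j < Y.rowLen i ↔ i < Y.colLen j := by rw [← mem_iff_lt_colLen, mem_iff_lt_rowLen]
  have h2 : j + 1 < Y.rowLen i ↔ i < Y.colLen (j + 1) := by
    rw [← mem_iff_lt_colLen, mem_iff_lt_rowLen]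
  have h3 := Y.colLen_anti 0 j (Nat.zero_le j)
  simp only [Finset.mem_filter, Finset.mem_range, Finset.mem_Ico]
  omega

theorem sum_rowLens (Y : YoungDiagram) : (Y.rowLens : Multiset ℕ).sum = Y.card := by
  change ∑ i ∈ Finset.range (Y.colLen 0), Y.rowLen i = Y.cells.card
  rw [Finset.card_eq_sum_card_fiberwise (f := Prod.fst) (t := Finset.range (Y.colLen 0))]
  · refine Finset.sum_congr rfl fun i _ => ?_
    rw [rowLen_eq_card]
    rfl
  · rintro ⟨i, j⟩ hs
    rw [Finset.mem_coe, Finset.mem_range]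
    exact mem_iff_lt_colLen.mp (Y.up_left_mem le_rfl (Nat.zero_le j) ((mem_cells _).mp hs))

/-- The partition of `N` into the row lengths of a Young diagram with `N` boxes. -/
def toPartition {N : ℕ} (Y : YoungDiagram) (hY : Y.card = N) : N.Partition where
  parts := Y.rowLens
  parts_pos {i} hi := Y.pos_of_mem_rowLens i hi
  parts_sum := Y.sum_rowLens.trans hY

theorem prod_parts_toPartition {R : Type*} [CommSemiring R] (x : R) (c : ℕ) {N : ℕ}
    (Y : YoungDiagram) (hY : Y.card = N) :
    (Y.toPartition hY).parts.toFinsupp.prod (fun _ m => x ^ (m / c)) = x ^ rowEndCount c Y := by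
  have h0 : ∀ i ∈ Y.rowLens, i ∈ (Finset.range (Y.rowLen 0)).image (· + 1) := by
    intro i hi
    have hpos := Y.pos_of_mem_rowLens i hi
    obtain ⟨k, -, rfl⟩ := List.mem_map.mp hi
    have := Y.rowLen_anti 0 k (Nat.zero_le k)
    exact Finset.mem_image.mpr ⟨Y.rowLen k - 1, Finset.mem_range.mpr (by omega), by omega⟩
  rw [Finsupp.prod_of_support_subset _ (s := (Finset.range (Y.rowLen 0)).image (· + 1))]
  · rw [Finset.prod_image (by simp), rowEndCount_eq_sum, ← Finset.prod_pow_eq_pow_sum]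
    refine Finset.prod_congr rfl fun j _ => ?_
    rw [Multiset.toFinsupp_apply]
    exact congrArg (fun m => x ^ (m / c)) (count_rowLens Y j)
  · intro i hi
    rw [Multiset.toFinsupp_support, Multiset.mem_toFinset] at hi
    exact h0 i hi
  · simp

theorem sum_rowEndCount {R : Type*} [CommSemiring R] (x : R) (c N : ℕ) :
    ∑ Y ∈ ofCard N, x ^ rowEndCount c Y =
      ∑ p : N.Partition, p.parts.toFinsupp.prod fun _ m => x ^ (m / c) := by
  refine Finset.sum_bij (fun Y hY => Y.toPartition (mem_ofCard.mp hY)) ?_ ?_ ?_ ?_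
  · intros; exact Finset.mem_univ _
  · intro Y hY Y' hY' h
    have h1 : (Y.rowLens : Multiset ℕ) = Y'.rowLens := congrArg Nat.Partition.parts h
    have h2 : Y.rowLens = Y'.rowLens :=
      (Multiset.coe_eq_coe.mp h1).eq_of_sortedGE Y.rowLens_sorted Y'.rowLens_sorted
    exact equivListRowLens.injective (Subtype.ext h2)
  · intro p _
    have hsort : (p.parts.sort (· ≥ ·)).SortedGE := (Multiset.pairwise_sort _ _).sortedGE
    have hpos : ∀ i ∈ p.parts.sort (· ≥ ·), 0 < i := fun i hi =>
      p.parts_pos ((Multiset.mem_sort _).mp hi)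
    have hrow := rowLens_ofRowLens_eq_self (hw := hsort) hpos
    have hcard : (ofRowLens _ hsort).card = N := by
      rw [← sum_rowLens, hrow, Multiset.sort_eq, p.parts_sum]
    refine ⟨ofRowLens _ hsort, mem_ofCard.mpr hcard, Nat.Partition.ext ?_⟩
    change ((ofRowLens _ hsort).rowLens : Multiset ℕ) = p.parts
    rw [hrow, Multiset.sort_eq]
  · intro Y hY
    exact (prod_parts_toPartition x c Y _).symm

theorem sum_X_pow_armLegCount {α β : ℕ} (hα : 0 < α) (hβ : 0 < β) (hαβ : Nat.Coprime α β) (N : ℕ) :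
    ∑ Y ∈ ofCard N, (Polynomial.X : Polynomial ℤ) ^ Y.armLegCount α β =
      ∑ Y ∈ ofCard N, Polynomial.X ^ rowEndCount (α + β) Y := by
  refine Polynomial.map_injective (Int.castRingHom ℝ) (RingHom.injective_int _) ?_
  -- The walk argument divides by t-integers, so it gives the identity at real t > 0; that suffices
  -- for polynomials.
  refine Polynomial.eq_of_infinite_eval_eq _ _ ((Set.Ioi_infinite (0 : ℝ)).mono fun t ht => ?_)
  have hx : (0 : ℚ) < α / β := by positivity
  have := sum_lowerCount_eq_sum_rowEndCount (t := t) ht (c := α + β) (by omega) N hx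
  simpa [Polynomial.eval_finsetSum, Polynomial.map_sum, Polynomial.eval_map,
    Polynomial.eval₂_finsetSum, armLegCount_eq_lowerCount hα hβ hαβ] using this

end YoungDiagram

/-! ### Generating functions and infinite products -/

namespace QTSeries

open PowerSeries YoungDiagram

theorem eq_mul_inv {f g h : PowerSeries (Polynomial ℤ)} (hf : constantCoeff f = 1)
    (H : g * f = h) : g = h * inv f := by
  rw [← H, mul_assoc, mul_inv f hf, mul_one]

theorem summable_pow_div (c : ℕ) {n : ℕ} (hn : n ≠ 0) :
    Summable fun j => q ^ (j / c) * t ^ (n * j) := by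
  rw [← summable_nat_add_iff 1]
  convert! Nat.Partition.summable_genFun_term'
    (fun _ m => (Polynomial.X : Polynomial ℤ) ^ (m / c)) hn using 2 with j
  rw [smul_eq_C_mul, map_pow]
  rfl

/-- Replacing j by j + c multiplies a term by q t^(cn), and on the first c terms the power of q is
trivial; the sum thus solves a linear equation. -/
theorem tsum_pow_div {c : ℕ} (hc : 0 < c) {n : ℕ} (hn : n ≠ 0) :
    ∑' j, q ^ (j / c) * t ^ (n * j) =
      (∑ j ∈ Finset.range c, t ^ (n * j)) * inv (1 - q * t ^ (c * n)) := by
  refine eq_mul_inv (by simp [q, t, hc.ne', hn]) ?_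
  have hs := summable_pow_div c hn
  have h1 := hs.sum_add_tsum_nat_add c
  have h2 : ∀ j, q ^ ((j + c) / c) * t ^ (n * (j + c)) =
      q * t ^ (c * n) * (q ^ (j / c) * t ^ (n * j)) := by
    intro j
    rw [Nat.add_div_right _ hc]
    ring
  have h3 : ∑ j ∈ Finset.range c, q ^ (j / c) * t ^ (n * j) =
      ∑ j ∈ Finset.range c, t ^ (n * j) :=
    Finset.sum_congr rfl fun j hj => by
      rw [Nat.div_eq_of_lt (Finset.mem_range.mp hj), pow_zero, one_mul]
  simp only [h2] at h1
  rw [hs.tsum_mul_left, h3] at h1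
  linear_combination -h1

theorem tsum_t_pow {n : ℕ} (hn : n ≠ 0) : ∑' j, t ^ (n * j) = inv (1 - t ^ n) := by
  have h := WithPiTopology.tsum_pow_mul_one_sub_of_constantCoeff_eq_zero (R := Polynomial ℤ) (f := t ^ n)
    (by simp [t, hn])
  simp only [← pow_mul] at h
  rw [eq_mul_inv (by simp [t, hn]) h, one_mul]

/-- Glaisher's theorem: partitions without parts divisible by c are equinumerous with those
repeating each part fewer than c times. The second form matches the finite sums in `tsum_pow_div`.
-/
theorem hasProd_not_dvd {c : ℕ} (hc : 0 < c) :
    HasProd (fun i : {i : ℕ // 1 ≤ i ∧ ¬ c ∣ i} => inv (1 - t ^ (i : ℕ)))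
      (PowerSeries.mk fun n => ((Nat.Partition.countRestricted n c).card : Polynomial ℤ)) := by
  have h := Nat.Partition.hasProd_powerSeriesMk_card_restricted (Polynomial ℤ) (¬ c ∣ ·)
  rw [Nat.Partition.powerSeriesMk_card_restricted_eq_powerSeriesMk_card_countRestricted _ hc] at h
  have hinj : Function.Injective fun i : {i : ℕ // 1 ≤ i ∧ ¬ c ∣ i} => (i : ℕ) - 1 := by
    intro i j hij
    have := i.2.1
    have := j.2.1
    exact Subtype.ext (by simp only at hij; omega)
  rw [← hinj.hasProd_iff] at h
  · convert! h using 2 with i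
    have hi : (i : ℕ) - 1 + 1 = i := Nat.sub_add_cancel i.2.1
    simp only [Function.comp_apply, hi, i.2.2, not_false_eq_true, if_true]
    exact (tsum_t_pow (by have := i.2.1; omega)).symm
  · intro i hi
    rw [if_neg]
    exact fun hd => hi ⟨⟨i + 1, by omega, hd⟩, rfl⟩

/-- These are the nontrivial factors of the generating function of partitions into multiples of c,
with q marking the number of parts. -/
theorem multipliable_inv_q (c : ℕ) (hc : 0 < c) :
    Multipliable fun i : {i : ℕ // 1 ≤ i} => inv (1 - q * t ^ (c * (i : ℕ))) := by
  have h := Nat.Partition.multipliable_genFun (fun i m => if c ∣ i then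
    (Polynomial.X : Polynomial ℤ) ^ m else 0)
  have hinj : Function.Injective fun i : {i : ℕ // 1 ≤ i} => c * (i : ℕ) - 1 := by
    intro i j hij
    have h1 := Nat.mul_pos hc i.2
    have h2 := Nat.mul_pos hc j.2
    exact Subtype.ext (Nat.eq_of_mul_eq_mul_left hc (by simp only at hij; omega))
  rw [← hinj.multipliable_iff] at h
  · convert! h using 2 with i
    have h1 := Nat.mul_pos hc i.2
    have hi : c * (i : ℕ) - 1 + 1 = c * i := Nat.sub_add_cancel h1
    have h2 := tsum_pow_div one_pos h1.ne'
    rw [(summable_pow_div 1 h1.ne').tsum_eq_zero_add] at h2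
    simp only [pow_zero, mul_zero, mul_one, one_mul, Finset.sum_range_one,
      Nat.div_one] at h2
    simp only [Function.comp_apply, hi, dvd_mul_right, if_true, smul_eq_C_mul, map_pow]
    exact h2.symm
  · intro i hi
    have hd : ¬ c ∣ i + 1 := by
      rintro ⟨k, hk⟩
      refine hi ⟨⟨k, Nat.pos_of_ne_zero ?_⟩, ?_⟩
      · rintro rfl
        simp at hk
      · simp only [← hk, Nat.add_sub_cancel]
    simp [hd]

theorem genFun_eq_mul {c : ℕ} (hc : 0 < c) :
    Nat.Partition.genFun (fun _ m => (Polynomial.X : Polynomial ℤ) ^ (m / c)) =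
      (∏' i : {i : ℕ // 1 ≤ i ∧ ¬ c ∣ i}, inv (1 - t ^ (i : ℕ))) *
        ∏' i : {i : ℕ // 1 ≤ i}, inv (1 - q * t ^ (c * (i : ℕ))) := by
  have h1 := Nat.Partition.hasProd_powerSeriesMk_card_countRestricted (Polynomial ℤ) hc
  have h2 := (multipliable_inv_q c hc).hasProd
  have hequiv : Function.Bijective fun i : ℕ => (⟨i + 1, by omega⟩ : {i : ℕ // 1 ≤ i}) :=
    ⟨fun i j hij => by simpa using hij, fun i => ⟨i - 1, Subtype.ext (Nat.sub_add_cancel i.2)⟩⟩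
  rw [← (Equiv.ofBijective _ hequiv).hasProd_iff] at h2
  have h3 := Nat.Partition.hasProd_genFun (fun _ m => (Polynomial.X : Polynomial ℤ) ^ (m / c))
  rw [(hasProd_not_dvd hc).tprod_eq]
  refine h3.unique ?_
  convert! h1.mul h2 using 2 with i
  have h4 := tsum_pow_div hc i.succ_ne_zero
  rw [(summable_pow_div c i.succ_ne_zero).tsum_eq_zero_add] at h4
  simp only [Nat.zero_div, pow_zero, mul_zero, mul_one] at h4
  simp only [smul_eq_C_mul, map_pow]
  exact h4

theorem hasSum_armLegCount {α β : ℕ} (hα : 0 < α) (hβ : 0 < β) (hαβ : Nat.Coprime α β) :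
    HasSum (fun Y : YoungDiagram => q ^ Y.armLegCount α β * t ^ Y.card)
      (Nat.Partition.genFun fun _ m => (Polynomial.X : Polynomial ℤ) ^ (m / (α + β))) := by
  classical
  rw [HasSum, WithPiTopology.tendsto_iff_coeff_tendsto]
  -- The coefficient of t^d is constant once a finite set contains all diagrams with d boxes.
  refine fun d => tendsto_atTop_of_eventually_const (i₀ := ofCard d) fun s hs => ?_
  rw [map_sum, Nat.Partition.coeff_genFun, ← sum_rowEndCount, ← sum_X_pow_armLegCount hα hβ hαβ]
  have h : ∀ Y : YoungDiagram, coeff d (q ^ Y.armLegCount α β * t ^ Y.card) =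
      if Y ∈ ofCard d then (Polynomial.X : Polynomial ℤ) ^ Y.armLegCount α β else 0 := by
    intro Y
    rw [q, t, ← map_pow, coeff_C_mul, coeff_X_pow]
    simp only [mem_ofCard, eq_comm (a := d), mul_ite, mul_one, mul_zero]
  simp only [h]
  rw [Finset.sum_ite_mem, Finset.inter_eq_right.mpr hs]

end QTSeries

theorem theorem2 (α β : ℕ) (hα : 0 < α) (hβ : 0 < β) (hαβ : Nat.Coprime α β) :
    Summable (fun Y : YoungDiagram => QTSeries.q ^ Y.armLegCount α β * QTSeries.t ^ Y.card) ∧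
    Multipliable (fun i : {i : ℕ // 1 ≤ i ∧ ¬ (α + β) ∣ i} =>
      QTSeries.inv (1 - QTSeries.t ^ (i : ℕ))) ∧
    Multipliable (fun i : {i : ℕ // 1 ≤ i} =>
      QTSeries.inv (1 - QTSeries.q * QTSeries.t ^ ((α + β) * (i : ℕ)))) ∧
    ∑' Y : YoungDiagram, QTSeries.q ^ Y.armLegCount α β * QTSeries.t ^ Y.card =
      (∏' i : {i : ℕ // 1 ≤ i ∧ ¬ (α + β) ∣ i}, QTSeries.inv (1 - QTSeries.t ^ (i : ℕ))) *
      ∏' i : {i : ℕ // 1 ≤ i},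
        QTSeries.inv (1 - QTSeries.q * QTSeries.t ^ ((α + β) * (i : ℕ))) := by
  have hc : 0 < α + β := by omega
  have h := QTSeries.hasSum_armLegCount hα hβ hαβ
  exact ⟨h.summable, (QTSeries.hasProd_not_dvd hc).multipliable, QTSeries.multipliable_inv_q _ hc,
    h.tsum_eq.trans (QTSeries.genFun_eq_mul hc)⟩
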